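/- Let $\mathbb F$ be a field with $2\neq 0$ in $\mathbb F$, let $\sigma_{\mathbb F}$ be the set of monic irreducible polynomials over $\mathbb F$, and let $\aleph$ be a multiplicity function, assigning a cardinal $\aleph(p,n)$ to every $p\in\sigma_{\mathbb F}$ and $n\ge 1$. For $p=X^d+a_{d-1}X^{d-1}+\dots+a_0\in\sigma_{\mathbb F}$ let $x_p$ be either the companion matrix of $p$ (ones below the diagonal, last column $-a_0,\dots,-a_{d-1}$), with $\epsilon=1$; or, throughout, if $\mathbb F=\mathbb R$, the matrix $\begin{pmatrix} r&-s\\ s&r\end{pmatrix}$ when $d=2$ and $p$ has roots $r\pm is$, $s>0$, and the root of $p$ when $d=1$, with $\epsilon=0$. Let $\mathbb F_p=\mathbb F[x_p]$, let $N_n$ be the $n\times n$ matrix with ones on the first superdiagonal and zeros elsewhere, and put $J(p,n)=\mathrm{id}_n\otimes x_p+N_n\otimes \mathrm{id}_d$. On the space $V$ with basis $(e_i)$ labelled by $i=(p,n,\alpha,m,k)$, $\alpha\in\aleph(p,n)$, $1\le m\le n$, $0\le k<\deg p$, define the block diagonal operators $$J(\aleph)=\bigoplus_{p,n,\alpha}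 J(p,n),\quad J((-1)\star\aleph)=\bigoplus_{p,n,\alpha} J((-1)\star p,n),\quad V(-1;\aleph)=\bigoplus_{p,n,\alpha} V_n(-1)\otimes V_{\deg p}(-1),\quad W(\aleph)=\bigoplus_{p,n,\alpha} P_n\otimes W_p^{\epsilon}.$$ Here $((-1)\star p)(X)=(-1)^{\deg p}p(-X)$; $V_n(\lambda)=\mathrm{diag}(\lambda,\lambda^2,\dots,\lambda^n)$; $P_n$ has ones on the antidiagonal and zeros elsewhere; and $W_p^\epsilon$ is the symmetric $d\times d$ matrix whose $(i,j)$ entry ($1\le i,j\le d$) is $0$ if $i+j\le d$, $1$ if $i+j=d+1$, $\epsilon\mu_1$ if $i+j=d+2$, and $\mu_{i+j-d-1}$ if $i+j>d+2$, where $\mu_n=-a_{d-n}-\sum_{k=1}^{n-1}a_{d-n+k}\mu_k$ for $1\le n\le d-1$. Let $L=\mathbf{aA}(\aleph)=\mathbb Fe_0\ltimes V$ be the Lie algebra in which $V$ is Abelian and $[e_0,v]=J(\aleph)v$ for $v\in V$, and let $\mathfrak h:L\to U(L)$ be the canonical map. For a basis $(b_i)$ of $V$ with the same labels put $x_i=\mathfrak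 h(b_i)$. For a matrix $A$ with finitely many nonzero entries in every column, $\operatorname{End}_{\mathbb F}(V)$ being identified with the set of these matrices, let $x^\top Ax=\sum_{i,j}A_{ij}x_ix_j$. If $A$ has infinitely many nonzero entries, this is a formal sum; it is called central if for every $w\in U(L)$ the sum $\sum_{i,j}A_{ij}[w,x_ix_j]$ converges to $0$ in the topology whose basic neighbourhoods of $0$ are the subspaces $\sum_{i\notin S}x_iU(L)$, $S$ finite. (1) There is a basis $(b_i)$ of $V$ with $[e_0,b_i]=\sum_jJ(\aleph)_{ij}b_j$ for all $i$ (that is, $\mathrm{ad}\,x=J(\aleph)x$ for the column $x=(x_i)$). For every such basis and every symmetric $A$ with finite columns, $x^\top Ax$ is central if and only if $$A=W(\aleph)\,V(-1;\aleph)\,C\quad\text{for some } C\in\operatorname{End}_{\mathbb F}(V)\text{ with } CJ(\aleph)=J((-1)\star\aleph)C .$$ Moreover the elements of $Z(U(L))$ that are linear combinations of the $x_ix_j$ are exactly the $x^\top Ax$ with $A$ symmetric, with finitely many nonzero entries, and of this form. (2) For the Jordan basis $b_i=e_i$ itself the same assertions hold with the condition $A=W(\aleph)V(-1;\aleph)C$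 replaced by $A\,W(\aleph)=V(-1;\aleph)\,C$. (3) Suppose that every $p$ with $\aleph(p,n)\ne0$ for some $n\ge2$ is separable. Then $C\in\operatorname{End}_{\mathbb F}(V)$ satisfies $CJ(\aleph)=J((-1)\star\aleph)C$ if and only if each of its blocks $C_{q,n,\beta;p,m,\alpha}$ (from the block space of $(p,m,\alpha)$ to that of $(q,n,\beta)$) is zero when $p\ne(-1)\star q$, and when $p=(-1)\star q$ is an $n\times m$ matrix over $\mathbb F_p$ of the form $$\begin{pmatrix}0&T\end{pmatrix}\ (m\ge n)\quad\text{or}\quad\begin{pmatrix}T\\0\end{pmatrix}\ (m<n),$$ where $T$ is the upper triangular $l\times l$ Toeplitz matrix with first row $(r_1,\dots,r_l)$, $r_1,\dots,r_l\in\mathbb F_p$, $l=\min\{m,n\}$. -/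

import Mathlib

universe u v

namespace JordAA

open Polynomial
open scoped Kronecker

noncomputable section

/-! ## Spectrum of a field, multiplicity functions, index sets -/

/-- The spectrum `σ_F`: monic irreducible polynomials over `F`. -/
def Spec (F : Type u) [Field F] : Type u := {p : F[X] // p.Monic ∧ Irreducible p}

/-- The degree of an element of the spectrum. -/
def Spec.deg {F : Type u} [Field F] (p : Spec F) : ℕ := p.1.natDegree

/-- The dilation `(l ⋆ P)(X) = l ^ (deg P) * P (X / l)`; the coefficient of `X ^ k` in `l ⋆ P` is
`l ^ (deg P - k) * a_k`. -/
def dil {F : Type u} [Field F] (l : F) (P : F[X]) : F[X] := P.scaleRoots l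

/-- An `ℕ`-graded multiplicity function (block sizes `n ≥ 1`). -/
abbrev MultFun (F : Type u) [Field F] : Type (max u (v + 1)) := Spec F → ℕ+ → Cardinal.{v}

/-- The Jordan blocks of a multiplicity function: triples `(p, n, α)` with `α ∈ ℵ(p, n)`. -/
structure Blk {F : Type u} [Field F] (a : MultFun.{u, v} F) : Type (max u v) where
  p : Spec F
  n : ℕ+
  α : (a p n).out

/-- Labels of the basis vectors of one Jordan block: `(m, k)` with `0 ≤ m < n`, `0 ≤ k < deg p`. -/
abbrev Blk.Pos {F : Type u} [Field F] {a : MultFun.{u, v} F} (b : Blk a) : Type :=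
  Fin (b.n : ℕ) × Fin b.p.deg

/-- Labels `(p, n, α, m, k)` of the basis of the whole space. -/
abbrev Idx {F : Type u} [Field F] (a : MultFun.{u, v} F) : Type (max u v) :=
  Σ b : Blk a, b.Pos

/-- The space `V = F ^ (dim ℵ)`, the direct sum of all the block spaces. Its endomorphisms are
exactly the matrices indexed by `Idx a` with finitely many nonzero entries in every column. -/
abbrev VSp {F : Type u} [Field F] (a : MultFun.{u, v} F) : Type (max u v) := Idx a →₀ F

/-- The `(i, j)` matrix entry of an operator in the standard basis. -/
def entry {F : Type u} [Field F] {I : Type v} (A : Module.End F (I →₀ F)) (i j : I) : F :=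
  A (Finsupp.single j 1) i

/-- The block diagonal operator with prescribed (finite) diagonal blocks. -/
def blockDiag {F : Type u} [Field F] {a : MultFun.{u, v} F}
    (B : (b : Blk a) → Matrix b.Pos b.Pos F) : Module.End F (VSp a) :=
  Finsupp.linearCombination F fun j : Idx a =>
    ∑ s : j.1.Pos, Finsupp.single (⟨j.1, s⟩ : Idx a) (B j.1 s j.2)

/-! ## The matrices `x_p` -/

/-- The companion matrix of a monic polynomial `P` of degree `d`: ones below the diagonal and
`-a_0, …, -a_{d-1}` in the last column. -/
def companionMat {F : Type u} [Field F] (P : F[X]) (d : ℕ) : Matrix (Fin d) (Fin d) F :=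
  fun i j => if (j : ℕ) + 1 = d then -P.coeff i else if (i : ℕ) = j + 1 then 1 else 0

/-- The traditional real form of `x_p`: for `d = 2`, the matrix `!![r, -s; s, r]`, where `r ± i s`,
`s > 0`, are the roots of the monic irreducible `P`; for `d = 1`, the root. -/
def realMat (P : ℝ[X]) (d : ℕ) : Matrix (Fin d) (Fin d) ℝ :=
  fun i j =>
    if d = 2 then
      if i = j then -(P.coeff 1 / 2)
      else if (i : ℕ) = 0 then -Real.sqrt (P.coeff 0 - (P.coeff 1 / 2) ^ 2)
      else Real.sqrt (P.coeff 0 - (P.coeff 1 / 2) ^ 2)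
    else companionMat P d i j

/-- The choice of the matrix representation of `x_p`: companion matrices, available over every
field, or, if `F` is (identified with) the field of real numbers, the traditional `2 × 2` form. -/
inductive MatRep (F : Type u) [Field F] : Type u where
  | companion : MatRep F
  | real (f : ℝ ≃+* F) : MatRep F

/-- The number `ε`: it is `1` for companion matrices and `0` for the traditional real form. -/
def MatRep.eps {F : Type u} [Field F] : MatRep F → F
  | .companion => 1
  | .real _ => 0

/-- The `d × d` matrix `x_P` of a monic irreducible polynomial `P` of degree `d`. -/
def MatRep.x {F : Type u} [Field F] : MatRep F → F[X] → (d : ℕ) → Matrix (Fin d) (Fin d) F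
  | .companion, P, d => companionMat P d
  | .real f, P, d => (realMat (P.map (f.symm : F →+* ℝ)) d).map f

/-! ## Jordan forms and the operators `W(ℵ)`, `V(-1; ℵ)` -/

/-- The nilpotent Jordan block: ones on the first superdiagonal. -/
def nilMat (F : Type u) [Field F] (n : ℕ) : Matrix (Fin n) (Fin n) F :=
  fun i j => if (j : ℕ) = i + 1 then 1 else 0

/-- The Jordan block `J(P, n) = id_n ⊗ x_P + N_n ⊗ id_d`, where `d = deg P`. -/
def jordanMat {F : Type u} [Field F] (R : MatRep F) (P : F[X]) (n d : ℕ) :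
    Matrix (Fin n × Fin d) (Fin n × Fin d) F :=
  (1 : Matrix (Fin n) (Fin n) F) ⊗ₖ R.x P d + nilMat F n ⊗ₖ (1 : Matrix (Fin d) (Fin d) F)

/-- The Jordan form `J(ℵ)`. -/
def jordan {F : Type u} [Field F] (R : MatRep F) (a : MultFun.{u, v} F) : Module.End F (VSp a) :=
  blockDiag fun b => jordanMat R b.p.1 b.n b.p.deg

/-- The Jordan form `J(l ⋆ ℵ)`. Since `(l ⋆ ℵ)(l ⋆ q, n) = ℵ(q, n)`, its blocks are labelled by the
blocks `(q, n, β)` of `ℵ`, and the one with this label is `J(l ⋆ q, n)`. -/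
def jordanDil {F : Type u} [Field F] (R : MatRep F) (l : F) (a : MultFun.{u, v} F) :
    Module.End F (VSp a) :=
  blockDiag fun b => jordanMat R (dil l b.p.1) b.n b.p.deg

/-- `P_n`: ones on the antidiagonal. -/
def antiMat (F : Type u) [Field F] (n : ℕ) : Matrix (Fin n) (Fin n) F :=
  fun i j => if (i : ℕ) + j + 1 = n then 1 else 0

/-- The numbers `μ_n` attached to `P = X ^ d + a_{d-1} X ^ (d-1) + … + a_0`: `μ_0 = 1` and
`μ_n = -a_{d-n} - ∑_{k=1}^{n-1} a_{d-n+k} μ_k` for `1 ≤ n ≤ d - 1`. -/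
def mu {F : Type u} [Field F] (P : F[X]) (d : ℕ) : ℕ → F
  | 0 => 1
  | n + 1 => -P.coeff (d - (n + 1)) -
      ∑ k : Fin n, P.coeff (d - (n + 1) + (k + 1)) * mu P d (k + 1)
decreasing_by omega

/-- The symmetric Hankel matrix `W_p^ε` of `P`, of size `d = deg P`: zeros above the antidiagonal,
ones on it, then `ε μ_1`, then `μ_2, …, μ_{d-1}`. -/
def wMat {F : Type u} [Field F] (e : F) (P : F[X]) (d : ℕ) : Matrix (Fin d) (Fin d) F :=
  fun i j =>
    if (i : ℕ) + j + 1 < d then 0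
    else if (i : ℕ) + j = d then e * mu P d 1
    else mu P d ((i : ℕ) + j + 1 - d)

/-- `V_n(l) = diag(l, l ^ 2, …, l ^ n)`. -/
def vMat {F : Type u} [Field F] (n : ℕ) (l : F) : Matrix (Fin n) (Fin n) F :=
  Matrix.diagonal fun i => l ^ ((i : ℕ) + 1)

/-- `W(ℵ)`, with the blocks `P_n ⊗ W_p^ε`. -/
def wOp {F : Type u} [Field F] (R : MatRep F) (a : MultFun.{u, v} F) : Module.End F (VSp a) :=
  blockDiag fun b => antiMat F b.n ⊗ₖ wMat R.eps b.p.1 b.p.deg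

/-- `V(-1; ℵ)`, with the blocks `V_n(-1) ⊗ V_{deg p}(-1)`; as `|-1| = 1` there is no dependence
on `ε`. -/
def vOp {F : Type u} [Field F] (a : MultFun.{u, v} F) : Module.End F (VSp a) :=
  blockDiag fun b => vMat (b.n : ℕ) (-1 : F) ⊗ₖ vMat b.p.deg (-1 : F)

/-- `C` is an intertwiner between `T₁` and `T₂`. -/
def IsIntertwiner {F : Type u} [Field F] {V : Type v} [AddCommGroup V] [Module F V]
    (T₁ T₂ C : Module.End F V) : Prop := C ∘ₗ T₁ = T₂ ∘ₗ C

/-- Block description of the intertwiners between `J(ℵ)` and `J((-1) ⋆ ℵ)`: the block from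
`(p, m, α)` to `(q, n, β)` vanishes unless `p = (-1) ⋆ q`, and then it is an `n × m` upper
triangular Toeplitz matrix, aligned to the top right, with entries `r_1, …, r_l`, `l = min m n`,
in the field `F_p = F[x_p]` of `d × d` matrices (`r k` below is `r_{k+1}`, and `m - n` is truncated
at zero). -/
def IsToeplitz {F : Type u} [Field F] (R : MatRep F) {a : MultFun.{u, v} F}
    (C : Module.End F (VSp a)) : Prop :=
  ∀ b c : Blk a,
    (c.p.1 ≠ dil (-1) b.p.1 → ∀ (s : b.Pos) (t : c.Pos), entry C ⟨b, s⟩ ⟨c, t⟩ = 0) ∧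
    ∀ h : c.p.1 = dil (-1) b.p.1,
      ∃ r : ℕ → Matrix (Fin c.p.deg) (Fin c.p.deg) F,
        (∀ k, r k ∈ Algebra.adjoin F {R.x c.p.1 c.p.deg}) ∧
        ∀ (s : b.Pos) (t : c.Pos),
          entry C ⟨b, s⟩ ⟨c, t⟩ =
            if (s.1 : ℕ) + ((c.n : ℕ) - (b.n : ℕ)) ≤ t.1 then
              r ((t.1 : ℕ) - s.1 - ((c.n : ℕ) - (b.n : ℕ)))
                (Fin.cast (by simp only [Spec.deg, h, dil, natDegree_scaleRoots]) s.2) t.2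
            else 0

/-! ## The Lie algebra `F e₀ ⋉ V` -/

/-- The Lie algebra `F e₀ ⋉ V` in which `V` is an Abelian ideal and `[e₀, v] = T v`. -/
def AlmostAbelian {F : Type u} [Field F] {V : Type v} [AddCommGroup V] [Module F V]
    (_T : Module.End F V) : Type (max u v) := F × V

namespace AlmostAbelian

variable {F : Type u} [Field F] {V : Type v} [AddCommGroup V] [Module F V] (T : Module.End F V)

instance : AddCommGroup (AlmostAbelian T) := inferInstanceAs (AddCommGroup (F × V))

instance : Module F (AlmostAbelian T) := inferInstanceAs (Module F (F × V))

instance : Bracket (AlmostAbelian T) (AlmostAbelian T) :=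
  ⟨fun x y => ((0 : F), x.1 • T y.2 - y.1 • T x.2)⟩

theorem lie_fst (x y : AlmostAbelian T) : (⁅x, y⁆ : AlmostAbelian T).1 = 0 := rfl

theorem lie_snd (x y : AlmostAbelian T) :
    (⁅x, y⁆ : AlmostAbelian T).2 = x.1 • T y.2 - y.1 • T x.2 := rfl

theorem fst_add (x y : AlmostAbelian T) : (x + y).1 = x.1 + y.1 := rfl

theorem snd_add (x y : AlmostAbelian T) : (x + y).2 = x.2 + y.2 := rfl

theorem fst_smul (c : F) (x : AlmostAbelian T) : (c • x).1 = c * x.1 := rfl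

theorem snd_smul (c : F) (x : AlmostAbelian T) : (c • x).2 = c • x.2 := rfl

instance : LieRing (AlmostAbelian T) where
  add_lie x y z := by
    refine Prod.ext ?_ ?_
    · simp only [lie_fst, fst_add, add_zero]
    · simp only [lie_snd, fst_add, snd_add, map_add]
      module
  lie_add x y z := by
    refine Prod.ext ?_ ?_
    · simp only [lie_fst, fst_add, add_zero]
    · simp only [lie_snd, fst_add, snd_add, map_add]
      module
  lie_self x := by
    refine Prod.ext rfl ?_
    simp only [lie_snd, sub_self]
    rfl
  leibniz_lie x y z := by
    refine Prod.ext ?_ ?_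
    · simp only [lie_fst, fst_add, add_zero]
    · simp only [lie_fst, lie_snd, snd_add, map_sub, map_smul]
      module

instance : LieAlgebra F (AlmostAbelian T) where
  lie_smul c x y := by
    refine Prod.ext ?_ ?_
    · simp only [lie_fst, fst_smul, mul_zero]
    · simp only [lie_snd, fst_smul, snd_smul, map_smul]
      module

/-- The inclusion of the Abelian ideal `V`, composed with `𝔥 : L → U(L)`. -/
def gen (w : V) : UniversalEnvelopingAlgebra F (AlmostAbelian T) :=
  UniversalEnvelopingAlgebra.ι F (((0 : F), w) : AlmostAbelian T)

end AlmostAbelian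

/-- The Jordanable almost Abelian Lie algebra of `ℵ`: here `ad e₀ = J(ℵ)` on `V`. -/
abbrev aA {F : Type u} [Field F] (R : MatRep F) (a : MultFun.{u, v} F) : Type (max u v) :=
  AlmostAbelian (jordan R a)

/-! ## Quadratic Casimir elements

Below `b` is a basis of `V`, and `x_i = 𝔥(b_i)`. -/

section Casimir

variable {F : Type u} [Field F] {I : Type v} {V : Type v} [AddCommGroup V] [Module F V]
  (T : Module.End F V) (b : Module.Basis I F V)

/-- The element `x_i x_j` of `U(L)`. -/
def quadMon (ij : I × I) : UniversalEnvelopingAlgebra F (AlmostAbelian T) :=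
  AlmostAbelian.gen T (b ij.1) * AlmostAbelian.gen T (b ij.2)

/-- The span in `U(L)` of all `x_i u` with `i ∉ S` and `u ∈ U(L)`. For finite `S` these subspaces
are a base of neighbourhoods of zero of the topology in which infinite sums `∑ A_{ij} x_i x_j` are
formed. -/
def tail (S : Finset I) : Submodule F (UniversalEnvelopingAlgebra F (AlmostAbelian T)) :=
  Submodule.span F {z | ∃ i, i ∉ S ∧ ∃ w, z = AlmostAbelian.gen T (b i) * w}

/-- The formal quadratic expression `∑ A_{ij} x_i x_j` (possibly with infinitely many terms)
commutes with every element `w` of `U(L)`: the sum of the commutators `A_{ij} [w, x_i x_j]`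
converges to zero. -/
def FormallyCentral (A : Module.End F (I →₀ F)) : Prop :=
  ∀ w : UniversalEnvelopingAlgebra F (AlmostAbelian T), ∀ S : Finset I,
    ∃ K₀ : Finset (I × I), ∀ K : Finset (I × I), K₀ ⊆ K →
      ∑ ij ∈ K, entry A ij.1 ij.2 • (w * quadMon T b ij - quadMon T b ij * w) ∈ tail T b S

/-- The matrix of `A` is symmetric. -/
def IsSymm (A : Module.End F (I →₀ F)) : Prop := ∀ i j, entry A i j = entry A j i

/-- The condition `P` on `A` describes the quadratic Casimir elements `xᵀ A x`.
First, among the symmetric matrices `A` with finite columns (the endomorphisms of `I →₀ F`), those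
for which the formal expression `xᵀ A x` is central are the ones with `P A`. Secondly, the elements
of the centre of `U(L)` that are linear combinations of the products `x_i x_j` are the sums
`xᵀ A x = ∑ A_{ij} x_i x_j` over the symmetric `A` with `P A` and finitely many nonzero entries. -/
def DescribesCasimirs (P : Module.End F (I →₀ F) → Prop) : Prop :=
  (∀ A : Module.End F (I →₀ F), IsSymm A → (FormallyCentral T b A ↔ P A)) ∧
  ∀ Q : UniversalEnvelopingAlgebra F (AlmostAbelian T),
    (Q ∈ Submodule.span F (Set.range (quadMon T b)) ∧ Q ∈ Subalgebra.center F
        (UniversalEnvelopingAlgebra F (AlmostAbelian T))) ↔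
      ∃ A : Module.End F (I →₀ F), IsSymm A ∧ {ij : I × I | entry A ij.1 ij.2 ≠ 0}.Finite ∧ P A ∧
        Q = ∑ᶠ ij : I × I, entry A ij.1 ij.2 • quadMon T b ij

end Casimir

/-- The basis `b` of `V`, written as a column, satisfies `ad b = J(ℵ) b` as a product of a matrix and
a column, that is, `[e₀, b_i] = ∑_j J(ℵ)_{ij} b_j` for all `i`. -/
def IsColumnAdapted {F : Type u} [Field F] (R : MatRep F) {a : MultFun.{u, v} F}
    (b : Module.Basis (Idx a) F (VSp a)) : Prop :=
  ∀ (c : Blk a) (s : c.Pos),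
    jordan R a (b ⟨c, s⟩) = ∑ t : c.Pos, jordanMat R c.p.1 c.n c.p.deg s t • b ⟨c, t⟩

end

end JordAA

namespace JordAA

open Polynomial
open scoped Kronecker Matrix

/-! ## Blocks of an operator -/

section Blocks

variable {F : Type u} [Field F]

/-! The `x_i` commute with one another, so centrality of a quadratic expression is tested by `e₀`
alone. If `T` has diagonal blocks `B` in the basis `b`, the Leibniz rule turns `[e₀, xᵀ A x]` into
`xᵀ (B A + A Bᵀ) x`. For symmetric `A` this coefficient matrix is again symmetric, and it must
vanish: `U(L)` acts on polynomials, `e₀` by a derivation and `V` by multiplication, and the second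
derivatives at zero of `u · 1` recover twice the coefficients of a symmetric quadratic expression.
This replaces the Poincaré–Birkhoff–Witt theorem and is where `2 ≠ 0` enters. These second
derivatives also vanish on small enough neighbourhoods of zero, so the argument covers formal sums.
The converse works because the blocks are finite: over complete blocks the commutators cancel
exactly, and the remaining terms are small. All this is assembled in
`describesCasimirs_of_hasBlocks`.

What remains is linear algebra. In a column-adapted basis `B = Jᵀ` and the condition is `Jᵀ A + A J
= 0`; in the Jordan basis it is `J A + A Jᵀ = 0`. Since `W J = Jᵀ W` with `W` invertible, and `V J'
= -J V` with `V² = 1`, the substitutions `C = V W⁻¹ A` and `C = V A W` turn these conditions into `C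
J = J' C` (`exists_eq_mul_mul_iff`, `exists_mul_eq_mul_iff`).

Intertwiners are computed one pair of Jordan blocks at a time. The `F`-matrix entries group into
cells `X_{ij}` with `X_{ij} x + X_{i,j-1} = x' X_{ij} + X_{i+1,j}`. For coprime polynomials,
induction from the lower left corner kills every cell. For equal polynomials, `[x, X_{ij}] =
X_{i,j-1} - X_{i+1,j}` commutes with `x` by induction; for separable `P`, the identity `[P(x), z] =
P'(x) [x, z]` forces such a commutator to be zero. So the cells lie in the commutant of `x`, which
is `F[x]`, and are constant along diagonals (`mul_jordanMat_eq_iff_toeplitz`). -/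

theorem entry_ext {I : Type v} {A B : Module.End F (I →₀ F)}
    (h : ∀ i j, entry A i j = entry B i j) : A = B := by
  refine Finsupp.lhom_ext' fun j => LinearMap.ext_ring (Finsupp.ext fun i => h i j)

variable {a : MultFun.{u, v} F}

/-- The block of `A` from the block space of `c` to that of `b`. -/
noncomputable def block (A : Module.End F (VSp a)) (b c : Blk a) : Matrix b.Pos c.Pos F :=
  fun s t => entry A ⟨b, s⟩ ⟨c, t⟩

theorem block_ext {A B : Module.End F (VSp a)} (h : ∀ b c, block A b c = block B b c) : A = B :=
  entry_ext fun i j => congrFun (congrFun (h i.1 j.1) i.2) j.2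

theorem blockDiag_single (B : (b : Blk a) → Matrix b.Pos b.Pos F) (c : Blk a) (t : c.Pos) :
    blockDiag B (Finsupp.single (⟨c, t⟩ : Idx a) 1) =
      ∑ s : c.Pos, B c s t • Finsupp.single (⟨c, s⟩ : Idx a) (1 : F) := by
  simp [blockDiag]

theorem block_comp_blockDiag (A : Module.End F (VSp a)) (B : (b : Blk a) → Matrix b.Pos b.Pos F)
    (b c : Blk a) : block (A ∘ₗ blockDiag B) b c = block A b c * B c := by
  ext s t
  simp only [block, entry, LinearMap.comp_apply, blockDiag_single, map_sum, map_smul,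
    Finsupp.finsetSum_apply, Finsupp.smul_apply, Matrix.mul_apply, smul_eq_mul]
  exact Finset.sum_congr rfl fun _ _ => mul_comm _ _

theorem blockDiag_apply (B : (b : Blk a) → Matrix b.Pos b.Pos F) (v : VSp a) (b : Blk a)
    (s : b.Pos) : blockDiag B v ⟨b, s⟩ = ∑ t : b.Pos, B b s t * v ⟨b, t⟩ := by
  classical
  induction v using Finsupp.induction_linear with
  | zero => simp
  | add f g hf hg => simp [hf, hg, mul_add, Finset.sum_add_distrib]
  | single j r =>
    obtain ⟨c, t⟩ := j
    have h1 : (Finsupp.single (⟨c, t⟩ : Idx a) r) = r • Finsupp.single (⟨c, t⟩ : Idx a) (1 : F) := by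
      simp
    rw [h1, map_smul, blockDiag_single]
    simp only [Finsupp.smul_apply, Finsupp.finsetSum_apply, smul_eq_mul]
    by_cases hbc : c = b
    · subst hbc
      simp only [Finsupp.single_apply, Sigma.mk.injEq, heq_eq_eq, true_and, mul_ite, mul_one,
        mul_zero, Finset.sum_ite_eq', Finset.sum_ite_eq, Finset.mem_univ, if_true]
      exact mul_comm _ _
    · simp [hbc]

theorem block_blockDiag_comp (A : Module.End F (VSp a)) (B : (b : Blk a) → Matrix b.Pos b.Pos F)
    (b c : Blk a) : block (blockDiag B ∘ₗ A) b c = B b * block A b c := by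
  ext s t
  simp only [block, entry, LinearMap.comp_apply, blockDiag_apply, Matrix.mul_apply]

theorem blockDiag_comp (B B' : (b : Blk a) → Matrix b.Pos b.Pos F) :
    blockDiag B ∘ₗ blockDiag B' = blockDiag fun b => B b * B' b := by
  refine Finsupp.lhom_ext' fun j => LinearMap.ext_ring (Finsupp.ext fun i => ?_)
  obtain ⟨b, s⟩ := i
  simp only [LinearMap.comp_apply, blockDiag_apply, Finsupp.lsingle_apply, Matrix.mul_apply,
    Finset.mul_sum, Finset.sum_mul, mul_assoc]
  exact Finset.sum_comm

theorem blockDiag_one : blockDiag (fun b : Blk a => (1 : Matrix b.Pos b.Pos F)) = LinearMap.id := by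
  refine Finsupp.lhom_ext' fun j => LinearMap.ext_ring (Finsupp.ext fun i => ?_)
  obtain ⟨b, s⟩ := i
  simp [blockDiag_apply, Matrix.one_apply]

theorem isIntertwiner_blockDiag_iff (B B' : (b : Blk a) → Matrix b.Pos b.Pos F)
    (C : Module.End F (VSp a)) :
    IsIntertwiner (blockDiag B) (blockDiag B') C ↔
      ∀ b c, block C b c * B c = B' b * block C b c := by
  unfold IsIntertwiner
  constructor
  · intro h b c
    rw [← block_comp_blockDiag, ← block_blockDiag_comp, h]
  · intro h
    refine block_ext fun b c => ?_
    rw [block_comp_blockDiag, block_blockDiag_comp, h]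

end Blocks

/-! ## The matrices `x_p`, `W_p` and `V_d(-1)` -/

section Companion

variable {F : Type u} [Field F]

theorem companionMat_mulVec_single {P : F[X]} {d k : ℕ} (hk : k + 1 < d) :
    companionMat P d *ᵥ Pi.single ⟨k, by omega⟩ 1 = Pi.single ⟨k + 1, hk⟩ 1 := by
  ext i
  simp [companionMat, Pi.single_apply, Fin.ext_iff, hk.ne]

theorem companionMat_pow_mulVec {P : F[X]} {d : ℕ} (hd : 0 < d) (k : ℕ) (hk : k < d) :
    companionMat P d ^ k *ᵥ Pi.single ⟨0, hd⟩ 1 = Pi.single ⟨k, hk⟩ 1 := by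
  induction k with
  | zero => rw [pow_zero, Matrix.one_mulVec]
  | succ k ih =>
    rw [pow_succ', ← Matrix.mulVec_mulVec, ih (by omega), companionMat_mulVec_single hk]

/-- The first basis vector is cyclic, and the last column says exactly that `P(x)` kills it; since
`P(x)` commutes with powers of `x`, it kills every basis vector. -/
theorem aeval_companionMat {P : F[X]} (hP : P.Monic) {d : ℕ} (hd : P.natDegree = d) :
    aeval (companionMat P d) P = 0 := by
  rcases Nat.eq_zero_or_pos d with rfl | hpos
  · exact Subsingleton.elim _ _
  obtain ⟨e, rfl⟩ : ∃ e, d = e + 1 := ⟨d - 1, by omega⟩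
  have key : aeval (companionMat P (e + 1)) P *ᵥ Pi.single ⟨0, hpos⟩ 1 = 0 := by
    rw [aeval_eq_sum_range, hd, Finset.sum_range_succ, Matrix.add_mulVec, Matrix.sum_mulVec]
    rw [pow_succ', Matrix.smul_mulVec, ← Matrix.mulVec_mulVec,
      companionMat_pow_mulVec hpos e (by omega)]
    have hc : P.coeff (e + 1) = 1 := by rw [← hd]; exact hP
    ext i
    rw [Finset.sum_range]
    simp only [Matrix.smul_mulVec, companionMat_pow_mulVec hpos _ (Fin.is_lt _)]
    simp [companionMat, hc, Pi.single_apply]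
  ext i j
  have h2 : aeval (companionMat P (e + 1)) P *ᵥ Pi.single j 1 = 0 := by
    obtain ⟨k, hk⟩ := j
    have hcomm : aeval (companionMat P (e + 1)) P * companionMat P (e + 1) ^ k =
        companionMat P (e + 1) ^ k * aeval (companionMat P (e + 1)) P := by
      have : Commute (aeval (companionMat P (e + 1)) P)
          (aeval (companionMat P (e + 1)) (X ^ k : F[X])) := (Commute.all _ _).map _
      simpa using this.eq
    rw [← companionMat_pow_mulVec (P := P) hpos k hk, Matrix.mulVec_mulVec, hcomm,
      ← Matrix.mulVec_mulVec, key, Matrix.mulVec_zero]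
  have := congrFun h2 i
  simpa using this

theorem wMat_apply_of_lt {e : F} {P : F[X]} {d : ℕ} {i j : Fin d} (h : (i : ℕ) + j + 1 < d) :
    wMat e P d i j = 0 := if_pos h

theorem wMat_apply_of_add_eq {e : F} {P : F[X]} {d : ℕ} {i j : Fin d} (h : (i : ℕ) + j + 1 = d) :
    wMat e P d i j = 1 := by
  unfold wMat
  rw [if_neg (by omega), if_neg (by omega), h, Nat.sub_self, mu]

theorem wMat_one_apply {P : F[X]} {d : ℕ} (i j : Fin d) :
    wMat 1 P d i j = if (i : ℕ) + j + 1 < d then 0 else mu P d ((i : ℕ) + j + 1 - d) := by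
  unfold wMat
  split_ifs with h1 h2
  · rfl
  · rw [one_mul, h2, Nat.add_sub_cancel_left]
  · rfl

theorem wMat_transpose (e : F) (P : F[X]) (d : ℕ) : (wMat e P d).transpose = wMat e P d := by
  ext i j
  simp only [Matrix.transpose_apply, wMat, Nat.add_comm (j : ℕ) (i : ℕ)]

/-- With `μ_0 = 1` the free term becomes the summand `m = 0`. For indices up to `d` and monic `P` of
degree `d`, the `μ_n` are thus the power series coefficients of the inverse of the reversed
polynomial. -/
theorem mu_recursion {P : F[X]} (d n : ℕ) :
    mu P d (n + 1) = -∑ m ∈ Finset.range (n + 1), P.coeff (d - (n + 1) + m) * mu P d m := by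
  have h0 : mu P d 0 = 1 := by rw [mu]
  rw [mu, Finset.sum_range_succ', Finset.sum_range, h0, add_zero, mul_one]
  ring

/-- The companion matrix shifts the columns of the Hankel matrix by one; in the last column the
recursion supplies the next `μ`, up to `μ_d`. The product depends only on `i + j`, hence is
symmetric. -/
theorem wMat_mul_companionMat_apply {P : F[X]} {d : ℕ} (i j : Fin d) :
    (wMat 1 P d * companionMat P d) i j = if (i : ℕ) + j + 2 < d then 0 else
      mu P d ((i : ℕ) + j + 2 - d) := by
  have hi := i.2
  have hj := j.2
  rw [Matrix.mul_apply]
  by_cases hjd : (j : ℕ) + 1 = d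
  · simp only [companionMat, hjd, if_true]
    rw [if_neg (by omega), show (i : ℕ) + j + 2 - d = i + 1 by omega, mu_recursion]
    simp only [wMat_one_apply, mul_neg, Finset.sum_neg_distrib, neg_inj]
    rw [Fin.sum_univ_eq_sum_range
      (fun k => (if (i : ℕ) + k + 1 < d then 0 else mu P d (i + k + 1 - d)) * P.coeff k) d]
    obtain ⟨r, hr⟩ : ∃ r, d = r + (i + 1) := ⟨d - (i + 1), by omega⟩
    have hsplit : Finset.range d = Finset.range (r + (i + 1)) := by rw [← hr]
    rw [hsplit, Finset.sum_range_add, Finset.sum_eq_zero, zero_add]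
    · refine Finset.sum_congr rfl fun m _ => ?_
      rw [if_neg (by omega), show d - ((i : ℕ) + 1) = r by omega,
        show (i : ℕ) + (r + m) + 1 - d = m by omega, mul_comm]
    · intro m hm
      rw [Finset.mem_range] at hm
      rw [if_pos (by omega), zero_mul]
  · have hj1 : (j : ℕ) + 1 < d := by omega
    simp only [companionMat, hjd, if_false]
    rw [Finset.sum_eq_single (⟨j + 1, hj1⟩ : Fin d)]
    · simp only [if_true, mul_one, wMat_one_apply]
      rfl
    · intro k _ hk
      rw [if_neg (fun h => hk (Fin.ext h)), mul_zero]
    · simp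

theorem wMat_mul_companionMat {P : F[X]} {d : ℕ} :
    wMat 1 P d * companionMat P d = (companionMat P d).transpose * wMat 1 P d := by
  have h : (companionMat P d).transpose * wMat 1 P d =
      (wMat 1 P d * companionMat P d).transpose := by
    rw [Matrix.transpose_mul, wMat_transpose]
  rw [h]
  ext i j
  rw [Matrix.transpose_apply, wMat_mul_companionMat_apply, wMat_mul_companionMat_apply,
    Nat.add_comm (j : ℕ) (i : ℕ)]

/-- On the subdiagonal, neighbouring signs of `V` are opposite. In the last column the sign of row
`i` times the sign of the dilated coefficient is `-(-1)^d`, independent of `i`, and `(-1)^d` is the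
last entry of `V`. -/
theorem vMat_mul_companionMat_dil {P : F[X]} {d : ℕ} (hd : P.natDegree = d) :
    vMat d (-1 : F) * companionMat (dil (-1) P) d = -(companionMat P d * vMat d (-1 : F)) := by
  ext i j
  have hi := i.2
  simp only [vMat, Matrix.diagonal_mul, Matrix.neg_apply, Matrix.mul_diagonal, companionMat, dil,
    coeff_scaleRoots]
  split_ifs with h1 h2
  · rw [hd, h1]
    have : (-1 : F) ^ ((i : ℕ) + 1) * (-1) ^ (d - (i : ℕ)) = -(-1) ^ d := by
      rw [← pow_add, show (i : ℕ) + 1 + (d - i) = d + 1 by omega, pow_succ]; ring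
    linear_combination (-P.coeff i) * this
  · rw [h2]; ring
  · ring

theorem vMat_mul_self (d : ℕ) : vMat d (-1 : F) * vMat d (-1 : F) = 1 := by
  simp [vMat, Matrix.diagonal_mul_diagonal, ← mul_pow]

/-- Reversing the rows makes the matrix upper triangular with ones on the diagonal. -/
theorem isUnit_wMat (e : F) (P : F[X]) (d : ℕ) : IsUnit (wMat e P d) := by
  have h : IsUnit ((wMat e P d).submatrix Fin.revPerm (Equiv.refl _)) := by
    rw [Matrix.isUnit_iff_isUnit_det, Matrix.det_of_isUpperTriangular]
    · refine isUnit_iff_ne_zero.2 (Finset.prod_ne_zero_iff.2 fun i _ => ?_)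
      rw [Matrix.submatrix_apply, wMat_apply_of_add_eq]
      · exact one_ne_zero
      · have := i.2
        simp [Fin.val_rev]
        omega
    · intro i j hij
      have := i.2
      have hij' : (j : ℕ) < i := hij
      rw [Matrix.submatrix_apply, wMat_apply_of_lt]
      simp [Fin.val_rev]
      omega
  exact (Matrix.isUnit_submatrix_equiv _ _).1 h

end Companion

/-! ### The traditional real form of `x_p` -/

section RealForm

variable {F : Type u} [Field F]

/-- The imaginary part of the roots, transported to `F`. -/
noncomputable def imPart (f : ℝ ≃+* F) (P : F[X]) : F :=
  f (Real.sqrt (f.symm (P.coeff 0) - (f.symm (P.coeff 1) / 2) ^ 2))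

theorem real_x_two (f : ℝ ≃+* F) (P : F[X]) :
    (MatRep.real f).x P 2 =
      !![-(P.coeff 1 / 2), -imPart f P; imPart f P, -(P.coeff 1 / 2)] := by
  have h2 : f 2 = 2 := map_ofNat f 2
  ext i j
  fin_cases i <;> fin_cases j <;>
    simp [MatRep.x, realMat, imPart, coeff_map, h2]

theorem real_x_one (f : ℝ ≃+* F) (P : F[X]) :
    (MatRep.real f).x P 1 = companionMat P 1 := by
  ext i j
  simp [MatRep.x, realMat, companionMat, coeff_map]

theorem wMat_one (e : F) (P : F[X]) : wMat e P 1 = 1 := by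
  ext i j
  rw [Subsingleton.elim i j, Matrix.one_apply_eq, wMat_apply_of_add_eq (by omega)]

theorem wMat_zero_two (P : F[X]) : wMat 0 P 2 = !![0, 1; 1, 0] := by
  ext i j
  have h0 : mu P 2 0 = 1 := by rw [mu]
  fin_cases i <;> fin_cases j <;> simp [wMat, h0]

theorem natDegree_eq_one_or_two (f : ℝ ≃+* F) {P : F[X]} (hP : Irreducible P) :
    P.natDegree = 1 ∨ P.natDegree = 2 := by
  have h : Irreducible (P.map (f.symm : F →+* ℝ)) :=
    (MulEquiv.irreducible_iff (Polynomial.mapEquiv f.symm)).2 hP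
  have h1 := h.natDegree_le_two
  rw [natDegree_map] at h1
  have := hP.natDegree_pos
  omega

/-- `Real.sqrt` is zero on negative numbers, so the radicand must be shown nonnegative: otherwise
the quadratic formula gives a real root of an irreducible quadratic. -/
theorem imPart_sq (f : ℝ ≃+* F) {P : F[X]} (hm : P.Monic) (hP : Irreducible P)
    (hd : P.natDegree = 2) : imPart f P ^ 2 = P.coeff 0 - (P.coeff 1 / 2) ^ 2 := by
  set Q := P.map (f.symm : F →+* ℝ) with hQ
  have h : Irreducible Q := (MulEquiv.irreducible_iff (Polynomial.mapEquiv f.symm)).2 hP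
  have hQd : Q.natDegree = 2 := by rw [hQ, natDegree_map, hd]
  have h0 : 0 ≤ f.symm (P.coeff 0) - (f.symm (P.coeff 1) / 2) ^ 2 := by
    by_contra hneg
    push Not at hneg
    set t := f.symm (P.coeff 1) / 2 with ht
    have hs := Real.sq_sqrt (show 0 ≤ t ^ 2 - f.symm (P.coeff 0) by linarith)
    set s := Real.sqrt (t ^ 2 - f.symm (P.coeff 0))
    have h1 : Q.coeff 2 = 1 := by
      rw [hQ, coeff_map, ← hd, hm.coeff_natDegree, map_one]
    have hroot : Q.IsRoot (s - t) := by
      rw [IsRoot, eval_eq_sum_range, hQd]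
      simp only [Finset.sum_range_succ, Finset.sum_range_zero, h1]
      simp only [hQ, coeff_map, RingEquiv.coe_toRingHom]
      rw [show f.symm (P.coeff 1) = 2 * t by rw [ht]; ring]
      linear_combination hs
    exact h.not_isRoot_of_natDegree_ne_one (by omega) hroot
  have h2 : f 2 = 2 := map_ofNat f 2
  rw [imPart, ← map_pow, Real.sq_sqrt h0]
  simp [h2]

theorem imPart_dil (f : ℝ ≃+* F) {P : F[X]} (hd : P.natDegree = 2) :
    imPart f (dil (-1) P) = imPart f P := by
  simp [imPart, dil, coeff_scaleRoots, hd, neg_div]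

end RealForm

/-! ### Relations valid for both choices of `x_p` -/

section Rep

variable {F : Type u} [Field F]

theorem MatRep.aeval_x (R : MatRep F) {P : F[X]} (hm : P.Monic) (hP : Irreducible P) {d : ℕ}
    (hd : P.natDegree = d) : aeval (R.x P d) P = 0 := by
  cases R with
  | companion => exact aeval_companionMat hm hd
  | real f =>
    rcases natDegree_eq_one_or_two f hP with h | h <;> obtain rfl := hd.symm.trans h
    · rw [real_x_one]
      exact aeval_companionMat hm h
    · have hs := imPart_sq f hm hP h
      have h1 : P.coeff 2 = 1 := by rw [← h]; exact hm
      have h2 : (2 : F) ≠ 0 := by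
        rw [← map_ofNat f 2]; simp
      rw [aeval_eq_sum_range, h, real_x_two]
      simp only [Finset.sum_range_succ, Finset.sum_range_zero, h1, pow_two, pow_zero, pow_one]
      ext i j
      fin_cases i <;> fin_cases j <;> simp <;> field_simp <;>
        field_simp at hs <;> first | ring1 | linear_combination -hs

theorem MatRep.wMat_mul_x (R : MatRep F) {P : F[X]} (hP : Irreducible P) {d : ℕ}
    (hd : P.natDegree = d) : wMat R.eps P d * R.x P d = (R.x P d).transpose * wMat R.eps P d := by
  cases R with
  | companion => exact wMat_mul_companionMat
  | real f =>
    rcases natDegree_eq_one_or_two f hP with h | h <;> obtain rfl := hd.symm.trans h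
    · rw [wMat_one, one_mul, mul_one]
      ext i j
      rw [Matrix.transpose_apply, Subsingleton.elim i j]
    -- With `ε = 0` the matrix `W` is the plain flip, and flipping the rows of a matrix with equal
    -- diagonal entries makes it symmetric.
    · rw [real_x_two, MatRep.eps, wMat_zero_two]
      ext i j
      fin_cases i <;> fin_cases j <;> simp [Matrix.mul_apply, Fin.sum_univ_two]

theorem MatRep.vMat_mul_x_dil (R : MatRep F) {P : F[X]} (hP : Irreducible P) {d : ℕ}
    (hd : P.natDegree = d) :
    vMat d (-1 : F) * R.x (dil (-1) P) d = -(R.x P d * vMat d (-1 : F)) := by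
  cases R with
  | companion => exact vMat_mul_companionMat_dil hd
  | real f =>
    rcases natDegree_eq_one_or_two f hP with h | h <;> obtain rfl := hd.symm.trans h
    · rw [real_x_one, real_x_one]
      exact vMat_mul_companionMat_dil hd
    · rw [real_x_two, real_x_two, imPart_dil f h]
      ext i j
      fin_cases i <;> fin_cases j <;>
        simp [vMat, dil, coeff_scaleRoots, h, neg_div, Matrix.mul_diagonal, Matrix.diagonal_mul, -Matrix.cons_mul]

end Rep

/-! ## Jordan blocks -/

section JordanBlocks

variable {F : Type u} [Field F]

theorem antiMat_mul_self (n : ℕ) : antiMat F n * antiMat F n = 1 := by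
  ext i j
  have hi := i.2
  have hj := j.2
  rw [Matrix.mul_apply, Finset.sum_eq_single (Fin.rev i)]
  · simp only [antiMat, Fin.val_rev, Matrix.one_apply, Fin.ext_iff]
    rw [if_pos (by omega), one_mul]
    exact if_congr (by omega) rfl rfl
  · intro k _ hk
    have : (i : ℕ) + k + 1 ≠ n := fun h => hk (Fin.ext (by rw [Fin.val_rev]; omega))
    simp [antiMat, this]
  · simp

theorem antiMat_mul_nilMat (n : ℕ) :
    antiMat F n * nilMat F n = (nilMat F n).transpose * antiMat F n := by
  ext i j
  have hi := i.2
  have hj := j.2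
  rw [Matrix.mul_apply, Matrix.mul_apply, Finset.sum_eq_single (Fin.rev i),
    Finset.sum_eq_single (Fin.rev j)]
  · simp only [antiMat, nilMat, Fin.val_rev, Matrix.transpose_apply]
    rw [if_pos (by omega), one_mul, if_pos (show n - (↑j + 1) + ↑j + 1 = n by omega), mul_one]
    exact if_congr (by omega) rfl rfl
  · intro k _ hk
    have : (k : ℕ) + j + 1 ≠ n := fun h => hk (Fin.ext (by rw [Fin.val_rev]; omega))
    simp [antiMat, this]
  · simp
  · intro k _ hk
    have : (i : ℕ) + k + 1 ≠ n := fun h => hk (Fin.ext (by rw [Fin.val_rev]; omega))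
    simp [antiMat, this]
  · simp

theorem vMat_mul_nilMat (n : ℕ) :
    vMat n (-1 : F) * nilMat F n = -(nilMat F n * vMat n (-1 : F)) := by
  ext i j
  simp only [vMat, Matrix.diagonal_mul, Matrix.neg_apply, Matrix.mul_diagonal, nilMat]
  split_ifs with h
  · rw [h]; ring
  · ring

theorem wBlock_mul_jordanMat (R : MatRep F) {P : F[X]} (hP : Irreducible P) {n d : ℕ}
    (hd : P.natDegree = d) :
    (antiMat F n ⊗ₖ wMat R.eps P d) * jordanMat R P n d =
      (jordanMat R P n d).transpose * (antiMat F n ⊗ₖ wMat R.eps P d) := by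
  have ht : ∀ (A : Matrix (Fin n) (Fin n) F) (B : Matrix (Fin d) (Fin d) F),
      (A ⊗ₖ B)ᵀ = Aᵀ ⊗ₖ Bᵀ := fun A B => rfl
  simp only [jordanMat, Matrix.transpose_add, mul_add, add_mul, ht,
    ← Matrix.mul_kronecker_mul, R.wMat_mul_x hP hd, antiMat_mul_nilMat, Matrix.transpose_one,
    one_mul, mul_one]

/-- Each summand of the Jordan block gets its sign from one tensor factor: the semisimple-looking
part `id ⊗ x` from `V_d`, the part `N ⊗ id` from `V_n`. -/
theorem vBlock_mul_jordanMat_dil (R : MatRep F) {P : F[X]} (hP : Irreducible P) {n d : ℕ}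
    (hd : P.natDegree = d) :
    (vMat n (-1 : F) ⊗ₖ vMat d (-1 : F)) * jordanMat R (dil (-1) P) n d =
      -(jordanMat R P n d * (vMat n (-1 : F) ⊗ₖ vMat d (-1 : F))) := by
  have h1 : ∀ (A : Matrix (Fin n) (Fin n) F) (B : Matrix (Fin d) (Fin d) F),
      A ⊗ₖ (-B) = -(A ⊗ₖ B) := fun A B => by ext; simp
  have h2 : ∀ (A : Matrix (Fin n) (Fin n) F) (B : Matrix (Fin d) (Fin d) F),
      (-A) ⊗ₖ B = -(A ⊗ₖ B) := fun A B => by ext; simp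
  simp only [jordanMat, mul_add, add_mul, ← Matrix.mul_kronecker_mul, R.vMat_mul_x_dil hP hd,
    vMat_mul_nilMat, one_mul, mul_one, h1, h2, neg_add]

theorem isUnit_wBlock (R : MatRep F) (P : F[X]) (n d : ℕ) :
    IsUnit (antiMat F n ⊗ₖ wMat R.eps P d) := by
  obtain ⟨w, hw⟩ := isUnit_wMat R.eps P d
  refine IsUnit.of_mul_eq_one (antiMat F n ⊗ₖ (↑w⁻¹ : Matrix (Fin d) (Fin d) F)) ?_
  rw [← Matrix.mul_kronecker_mul, antiMat_mul_self, ← hw, Units.mul_inv, Matrix.one_kronecker_one]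

theorem vBlock_mul_self (n d : ℕ) :
    (vMat n (-1 : F) ⊗ₖ vMat d (-1 : F)) * (vMat n (-1 : F) ⊗ₖ vMat d (-1 : F)) = 1 := by
  rw [← Matrix.mul_kronecker_mul, vMat_mul_self, vMat_mul_self, Matrix.one_kronecker_one]

end JordanBlocks

/-! ## The enveloping algebra acting on polynomials -/

section Action

attribute [local instance 100] LieRing.ofAssociativeRing

variable {F : Type u} [Field F] {I : Type v} {V : Type v} [AddCommGroup V] [Module F V]
  (T : Module.End F V) (b : Module.Basis I F V)

/-- The linear form of `MvPolynomial I F` with the coordinates of `v`. -/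
noncomputable def linForm : V →ₗ[F] MvPolynomial I F := b.constr F fun i => MvPolynomial.X i

@[simp]
theorem linForm_basis (i : I) : linForm b (b i) = MvPolynomial.X i := b.constr_basis _ _ _

/-- The derivation of the polynomial algebra which extends `T`. -/
noncomputable def derivExt : Derivation F (MvPolynomial I F) (MvPolynomial I F) :=
  MvPolynomial.mkDerivation F fun i => linForm b (T (b i))

theorem derivExt_linForm (v : V) : derivExt T b (linForm b v) = linForm b (T v) := by
  have h : (derivExt T b : MvPolynomial I F →ₗ[F] MvPolynomial I F) ∘ₗ linForm b =
      linForm b ∘ₗ T := by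
    refine b.ext fun i => ?_
    simp [derivExt, MvPolynomial.mkDerivation_X]
  exact LinearMap.congr_fun h v

/-- The operator on polynomials by which `c e₀ + v` acts: `e₀` acts by a derivation, `v` by
multiplication. -/
noncomputable def polyOp (c : F) (v : V) : Module.End F (MvPolynomial I F) :=
  c • (derivExt T b : MvPolynomial I F →ₗ[F] MvPolynomial I F) + LinearMap.mulLeft F (linForm b v)

theorem polyOp_apply (c : F) (v : V) (f : MvPolynomial I F) :
    polyOp T b c v f = c • derivExt T b f + linForm b v * f := rfl

/-- The action of `F e₀ ⋉ V` on polynomials. -/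
noncomputable def polyAction : AlmostAbelian T →ₗ⁅F⁆ Module.End F (MvPolynomial I F) where
  toFun x := polyOp T b x.1 x.2
  map_add' x y := by
    refine LinearMap.ext fun f => ?_
    rw [AlmostAbelian.fst_add, AlmostAbelian.snd_add, LinearMap.add_apply]
    simp only [polyOp_apply, map_add, add_smul, add_mul]
    abel
  map_smul' c x := by
    refine LinearMap.ext fun f => ?_
    rw [AlmostAbelian.fst_smul, AlmostAbelian.snd_smul, LinearMap.smul_apply]
    simp only [polyOp_apply, map_smul, RingHom.id_apply, smul_add, mul_smul, smul_mul_assoc]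
  map_lie' := by
    intro x y
    refine LinearMap.ext fun f => ?_
    rw [AlmostAbelian.lie_fst, AlmostAbelian.lie_snd, LieRing.of_associative_ring_bracket,
      LinearMap.sub_apply, Module.End.mul_apply, Module.End.mul_apply]
    generalize x.1 = c, x.2 = v, y.1 = c', y.2 = v'
    simp only [polyOp_apply, map_sub, map_smul, map_add, Derivation.leibniz, derivExt_linForm,
      smul_eq_mul, Algebra.smul_def, Derivation.map_algebraMap, zero_mul, map_zero]
    ring

/-- The polynomial `u · 1`, for `u` in the enveloping algebra. -/
noncomputable def symbol : UniversalEnvelopingAlgebra F (AlmostAbelian T) →ₗ[F] MvPolynomial I F :=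
  LinearMap.applyₗ (1 : MvPolynomial I F) ∘ₗ
    (UniversalEnvelopingAlgebra.lift F (polyAction T b)).toLinearMap

theorem symbol_gen_mul (v : V) (w : UniversalEnvelopingAlgebra F (AlmostAbelian T)) :
    symbol T b (AlmostAbelian.gen T v * w) = linForm b v * symbol T b w := by
  have h : UniversalEnvelopingAlgebra.lift F (polyAction T b) (AlmostAbelian.gen T v) =
      polyOp T b 0 v := UniversalEnvelopingAlgebra.lift_ι_apply F (polyAction T b) _
  simp only [symbol, LinearMap.comp_apply, AlgHom.toLinearMap_apply, map_mul, h]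
  simp [polyOp_apply]

theorem symbol_gen (v : V) : symbol T b (AlmostAbelian.gen T v) = linForm b v := by
  have h := symbol_gen_mul T b v 1
  have h1 : symbol T b 1 = 1 := by simp [symbol]
  rwa [mul_one, h1, mul_one] at h

theorem symbol_quadMon (ij : I × I) :
    symbol T b (quadMon T b ij) = MvPolynomial.X ij.1 * MvPolynomial.X ij.2 := by
  rw [quadMon, symbol_gen_mul, symbol_gen, linForm_basis, linForm_basis]

/-- The mixed second derivative at zero of the polynomial `u · 1`. -/
noncomputable def hessian (k l : I) : UniversalEnvelopingAlgebra F (AlmostAbelian T) →ₗ[F] F :=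
  (MvPolynomial.aeval (0 : I → F)).toLinearMap ∘ₗ
    (MvPolynomial.pderiv (R := F) k : MvPolynomial I F →ₗ[F] MvPolynomial I F) ∘ₗ
    (MvPolynomial.pderiv (R := F) l : MvPolynomial I F →ₗ[F] MvPolynomial I F) ∘ₗ symbol T b

/-- Both orders of the pair contribute, and a square contributes twice, so a symmetric coefficient
is always seen with the factor 2. -/
theorem hessian_quadMon [DecidableEq I] (k l i j : I) :
    hessian T b k l (quadMon T b (i, j)) =
      (if i = k ∧ j = l then 1 else 0) + (if i = l ∧ j = k then 1 else 0) := by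
  simp only [hessian, LinearMap.comp_apply, symbol_quadMon, Derivation.coeFn_coe,
    Derivation.leibniz, MvPolynomial.pderiv_X, map_add, smul_eq_mul, AlgHom.toLinearMap_apply,
    map_mul, MvPolynomial.aeval_X, Pi.zero_apply, zero_mul, Pi.single_apply]
  by_cases h1 : i = k <;> by_cases h2 : j = l <;> by_cases h3 : i = l <;> by_cases h4 : j = k <;>
    grind

/-- After differentiation in the directions `k` and `l` a multiple of `X_i`, with `i ≠ k, l`, still
contains the factor `X_i`, and vanishes at zero. This makes the second derivatives continuous for
the topology of formal sums. -/
theorem hessian_eq_zero_of_mem_tail {k l : I} {S : Finset I} (hk : k ∈ S) (hl : l ∈ S)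
    {z : UniversalEnvelopingAlgebra F (AlmostAbelian T)} (hz : z ∈ tail T b S) :
    hessian T b k l z = 0 := by
  classical
  have hle : tail T b S ≤ LinearMap.ker (hessian T b k l) := by
    refine Submodule.span_le.2 ?_
    rintro _ ⟨i, hi, w, rfl⟩
    have hik : i ≠ k := fun h => hi (h ▸ hk)
    have hil : i ≠ l := fun h => hi (h ▸ hl)
    simp only [SetLike.mem_coe, LinearMap.mem_ker, hessian, LinearMap.comp_apply, symbol_gen_mul,
      linForm_basis, Derivation.coeFn_coe, Derivation.leibniz, MvPolynomial.pderiv_X,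
      Pi.single_apply, hik, hil, if_false, smul_eq_mul, mul_zero, add_zero,
      AlgHom.toLinearMap_apply, map_mul, MvPolynomial.aeval_X, Pi.zero_apply, zero_mul]
  exact hle hz

end Action

/-! ## Commutators in the enveloping algebra -/

section Commutators

attribute [local instance 100] LieRing.ofAssociativeRing

variable {F : Type u} [Field F] {V : Type v} [AddCommGroup V] [Module F V] (T : Module.End F V)

/-- The element `c e₀ + v`. -/
def AlmostAbelian.mk (c : F) (v : V) : AlmostAbelian T := (c, v)

theorem gen_eq (v : V) :
    AlmostAbelian.gen T v = UniversalEnvelopingAlgebra.ι F (AlmostAbelian.mk T 0 v) := rfl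

theorem gen_add (v w : V) :
    AlmostAbelian.gen T (v + w) = AlmostAbelian.gen T v + AlmostAbelian.gen T w := by
  have h : AlmostAbelian.mk T 0 (v + w) = AlmostAbelian.mk T 0 v + AlmostAbelian.mk T 0 w :=
    Prod.ext (add_zero 0).symm rfl
  rw [gen_eq, h, map_add]
  rfl

theorem gen_smul (c : F) (v : V) : AlmostAbelian.gen T (c • v) = c • AlmostAbelian.gen T v := by
  have h : AlmostAbelian.mk T 0 (c • v) = c • AlmostAbelian.mk T 0 v :=
    Prod.ext (mul_zero c).symm rfl
  rw [gen_eq, h, map_smul]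
  rfl

/-- `v ↦ 𝔥(v)` as a linear map. -/
noncomputable def genₗ : V →ₗ[F] UniversalEnvelopingAlgebra F (AlmostAbelian T) where
  toFun := AlmostAbelian.gen T
  map_add' := gen_add T
  map_smul' := gen_smul T

theorem genₗ_apply (v : V) : genₗ T v = AlmostAbelian.gen T v := rfl

/-- The image of `e₀` in the enveloping algebra. -/
noncomputable def outer : UniversalEnvelopingAlgebra F (AlmostAbelian T) :=
  UniversalEnvelopingAlgebra.ι F (AlmostAbelian.mk T 1 0)

theorem mk_lie_mk (c c' : F) (v v' : V) :
    ⁅AlmostAbelian.mk T c v, AlmostAbelian.mk T c' v'⁆ =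
      AlmostAbelian.mk T 0 (c • T v' - c' • T v) := rfl

theorem gen_mul_comm (v w : V) :
    AlmostAbelian.gen T v * AlmostAbelian.gen T w =
      AlmostAbelian.gen T w * AlmostAbelian.gen T v := by
  have h := LieHom.map_lie (UniversalEnvelopingAlgebra.ι F) (AlmostAbelian.mk T 0 v)
    (AlmostAbelian.mk T 0 w)
  rw [mk_lie_mk, LieRing.of_associative_ring_bracket, zero_smul, zero_smul, sub_zero, ← gen_eq,
    ← gen_eq, ← gen_eq, ← genₗ_apply, map_zero] at h
  exact (sub_eq_zero.1 h.symm)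

theorem outer_mul_gen (v : V) :
    outer T * AlmostAbelian.gen T v = AlmostAbelian.gen T v * outer T +
      AlmostAbelian.gen T (T v) := by
  have h := LieHom.map_lie (UniversalEnvelopingAlgebra.ι F) (AlmostAbelian.mk T 1 0)
    (AlmostAbelian.mk T 0 v)
  rw [mk_lie_mk, LieRing.of_associative_ring_bracket, zero_smul, one_smul, sub_zero, ← gen_eq,
    ← gen_eq] at h
  exact sub_eq_iff_eq_add'.1 h.symm

theorem ι_eq (x : AlmostAbelian T) :
    UniversalEnvelopingAlgebra.ι F x = x.1 • outer T + AlmostAbelian.gen T x.2 := by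
  obtain ⟨c, v⟩ := x
  have h : AlmostAbelian.mk T c v = c • AlmostAbelian.mk T 1 0 + AlmostAbelian.mk T 0 v := by
    refine Prod.ext ?_ ?_
    · rw [AlmostAbelian.fst_add, AlmostAbelian.fst_smul]
      simp [AlmostAbelian.mk]
    · rw [AlmostAbelian.snd_add, AlmostAbelian.snd_smul]
      simp [AlmostAbelian.mk]
  change UniversalEnvelopingAlgebra.ι F (AlmostAbelian.mk T c v) = _
  rw [h, map_add, map_smul]
  rfl

/-- Induction principle for the enveloping algebra of an almost Abelian Lie algebra. -/
theorem enveloping_induction {p : UniversalEnvelopingAlgebra F (AlmostAbelian T) → Prop}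
    (scalar : ∀ c : F, p (algebraMap F _ c)) (h_outer : p (outer T))
    (h_gen : ∀ v, p (AlmostAbelian.gen T v)) (add : ∀ x y, p x → p y → p (x + y))
    (mul : ∀ x y, p x → p y → p (x * y)) (w : UniversalEnvelopingAlgebra F (AlmostAbelian T)) :
    p w := by
  let A : Subalgebra F (UniversalEnvelopingAlgebra F (AlmostAbelian T)) :=
    { carrier := {x | p x}
      mul_mem' := mul _ _
      add_mem' := add _ _
      algebraMap_mem' := scalar }
  have hι : ∀ x : AlmostAbelian T, UniversalEnvelopingAlgebra.ι F x ∈ A := fun x => by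
    rw [ι_eq]
    exact A.add_mem (A.smul_mem h_outer _) (h_gen _)
  let f : AlmostAbelian T →ₗ⁅F⁆ A :=
    { toFun := fun x => ⟨UniversalEnvelopingAlgebra.ι F x, hι x⟩
      map_add' := fun x y => Subtype.ext (map_add _ x y)
      map_smul' := fun c x => Subtype.ext (map_smul _ c x)
      map_lie' := fun {x y} => Subtype.ext (LieHom.map_lie _ x y) }
  -- By uniqueness in the universal property, the lift into `A` followed by the inclusion is the
  -- identity, so `A` is everything.
  have h : A.val.comp (UniversalEnvelopingAlgebra.lift F f) = AlgHom.id F _ := by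
    refine UniversalEnvelopingAlgebra.hom_ext _ (LieHom.ext fun x => ?_)
    change (UniversalEnvelopingAlgebra.lift F f (UniversalEnvelopingAlgebra.ι F x) :
      UniversalEnvelopingAlgebra F (AlmostAbelian T)) = UniversalEnvelopingAlgebra.ι F x
    rw [UniversalEnvelopingAlgebra.lift_ι_apply]
    rfl
  have hw := AlgHom.congr_fun h w
  change ((UniversalEnvelopingAlgebra.lift F f w : A) : UniversalEnvelopingAlgebra F _) = w at hw
  rw [← hw]
  exact (UniversalEnvelopingAlgebra.lift F f w).2

variable {I : Type v} (b : Module.Basis I F V)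

theorem gen_mul_quadMon (v : V) (ij : I × I) :
    AlmostAbelian.gen T v * quadMon T b ij = quadMon T b ij * AlmostAbelian.gen T v := by
  rw [quadMon, ← mul_assoc, gen_mul_comm, mul_assoc, gen_mul_comm T v, mul_assoc]

theorem quadMon_swap (i j : I) : quadMon T b (i, j) = quadMon T b (j, i) :=
  gen_mul_comm T _ _

theorem outer_comm_quadMon (ij : I × I) :
    outer T * quadMon T b ij - quadMon T b ij * outer T =
      AlmostAbelian.gen T (T (b ij.1)) * AlmostAbelian.gen T (b ij.2) +
        AlmostAbelian.gen T (b ij.1) * AlmostAbelian.gen T (T (b ij.2)) := by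
  rw [quadMon, ← mul_assoc, outer_mul_gen, add_mul, mul_assoc _ (outer T), outer_mul_gen]
  noncomm_ring

theorem gen_mul_mem_tail {S : Finset I} {i : I} (hi : i ∉ S)
    (w : UniversalEnvelopingAlgebra F (AlmostAbelian T)) :
    AlmostAbelian.gen T (b i) * w ∈ tail T b S := Submodule.subset_span ⟨i, hi, w, rfl⟩

/-- The neighbourhoods are right ideals by construction; stability under left multiplication needs
the block structure. -/
theorem mul_mem_tail {S : Finset I} {z : UniversalEnvelopingAlgebra F (AlmostAbelian T)}
    (hz : z ∈ tail T b S) (w : UniversalEnvelopingAlgebra F (AlmostAbelian T)) :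
    z * w ∈ tail T b S := by
  have h : tail T b S ≤ (tail T b S).comap (LinearMap.mulRight F w) := by
    refine Submodule.span_le.2 ?_
    rintro _ ⟨i, hi, w', rfl⟩
    simp only [SetLike.mem_coe, Submodule.mem_comap, LinearMap.mulRight_apply, mul_assoc]
    exact gen_mul_mem_tail T b hi _
  exact h hz

end Commutators

/-! ## Quadratic elements for operators with finite diagonal blocks -/

section Quadratic

variable {F : Type u} [Field F] {a : MultFun.{u, v} F} {T : Module.End F (VSp a)}
  {b : Module.Basis (Idx a) F (VSp a)} {B : (c : Blk a) → Matrix c.Pos c.Pos F}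

/-- The operator `T` has, in the basis `b`, the diagonal blocks `B`. -/
def HasBlocks (T : Module.End F (VSp a)) (b : Module.Basis (Idx a) F (VSp a))
    (B : (c : Blk a) → Matrix c.Pos c.Pos F) : Prop :=
  ∀ (c : Blk a) (s : c.Pos), T (b ⟨c, s⟩) = ∑ t : c.Pos, B c t s • b ⟨c, t⟩

/-- The labels of the blocks in `E`. -/
def blkLabels (E : Finset (Blk a)) : Finset (Idx a) := E.sigma fun _ => Finset.univ

theorem mem_blkLabels {E : Finset (Blk a)} {i : Idx a} : i ∈ blkLabels E ↔ i.1 ∈ E := by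
  simp [blkLabels]

theorem exists_subset_blkLabels (S : Finset (Idx a)) : ∃ E : Finset (Blk a), S ⊆ blkLabels E := by
  classical
  exact ⟨S.image Sigma.fst, fun i hi => mem_blkLabels.2 (Finset.mem_image_of_mem _ hi)⟩

theorem exists_subset_blkLabels_prod (K : Finset (Idx a × Idx a)) :
    ∃ E : Finset (Blk a), K ⊆ blkLabels E ×ˢ blkLabels E := by
  classical
  obtain ⟨E, hE⟩ := exists_subset_blkLabels (K.image Prod.fst ∪ K.image Prod.snd)
  refine ⟨E, fun ij hij => Finset.mem_product.2 ⟨hE ?_, hE ?_⟩⟩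
  · exact Finset.mem_union_left _ (Finset.mem_image_of_mem _ hij)
  · exact Finset.mem_union_right _ (Finset.mem_image_of_mem _ hij)

theorem gen_apply_basis (hT : HasBlocks T b B) (c : Blk a) (s : c.Pos) :
    AlmostAbelian.gen T (T (b ⟨c, s⟩)) = ∑ t, B c t s • AlmostAbelian.gen T (b ⟨c, t⟩) := by
  rw [hT, ← genₗ_apply, map_sum]
  simp only [map_smul, genₗ_apply]

theorem gen_apply_mul_mem_tail (hT : HasBlocks T b B) {E : Finset (Blk a)} {i : Idx a}
    (hi : i.1 ∉ E) (w : UniversalEnvelopingAlgebra F (AlmostAbelian T)) :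
    AlmostAbelian.gen T (T (b i)) * w ∈ tail T b (blkLabels E) := by
  obtain ⟨c, s⟩ := i
  rw [gen_apply_basis hT, Finset.sum_mul]
  refine Submodule.sum_mem _ fun t _ => ?_
  rw [smul_mul_assoc]
  exact Submodule.smul_mem _ _
    (gen_mul_mem_tail T b (i := ⟨c, t⟩) (fun h => hi (show c ∈ E from mem_blkLabels.1 h)) _)

theorem tail_anti {S S' : Finset (Idx a)} (h : S ⊆ S') : tail T b S' ≤ tail T b S :=
  Submodule.span_mono fun _ ⟨i, hi, hw⟩ => ⟨i, fun hi' => hi (h hi'), hw⟩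

/-- Moving `e₀` past `x_i` creates the image of `T b_i`, which stays in the block of `i`; hence the
restriction to unions of whole blocks. -/
theorem outer_mul_mem_tail (hT : HasBlocks T b B) {E : Finset (Blk a)}
    {z : UniversalEnvelopingAlgebra F (AlmostAbelian T)} (hz : z ∈ tail T b (blkLabels E)) :
    outer T * z ∈ tail T b (blkLabels E) := by
  have h : tail T b (blkLabels E) ≤
      (tail T b (blkLabels E)).comap (LinearMap.mulLeft F (outer T)) := by
    refine Submodule.span_le.2 ?_
    rintro _ ⟨i, hi, w, rfl⟩
    simp only [SetLike.mem_coe, Submodule.mem_comap, LinearMap.mulLeft_apply]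
    rw [← mul_assoc, outer_mul_gen, add_mul, mul_assoc]
    exact Submodule.add_mem _ (gen_mul_mem_tail T b hi _)
      (gen_apply_mul_mem_tail hT (fun h => hi (mem_blkLabels.2 h)) _)
  exact h hz

theorem gen_left_mul_mem_tail (v : VSp a) {S : Finset (Idx a)}
    {z : UniversalEnvelopingAlgebra F (AlmostAbelian T)} (hz : z ∈ tail T b S) :
    AlmostAbelian.gen T v * z ∈ tail T b S := by
  have h : tail T b S ≤ (tail T b S).comap (LinearMap.mulLeft F (AlmostAbelian.gen T v)) := by
    refine Submodule.span_le.2 ?_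
    rintro _ ⟨i, hi, w, rfl⟩
    simp only [SetLike.mem_coe, Submodule.mem_comap, LinearMap.mulLeft_apply]
    rw [← mul_assoc, gen_mul_comm, mul_assoc]
    exact gen_mul_mem_tail T b hi _
  exact h hz

/-- Left multiplication by a fixed element preserves the neighbourhoods of zero given by unions of
blocks. -/
theorem left_mul_mem_tail (hT : HasBlocks T b B) (E : Finset (Blk a))
    (w : UniversalEnvelopingAlgebra F (AlmostAbelian T)) :
    ∀ z ∈ tail T b (blkLabels E), w * z ∈ tail T b (blkLabels E) := by
  induction w using enveloping_induction with
  | scalar c =>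
    intro z hz
    rw [← Algebra.smul_def]
    exact Submodule.smul_mem _ _ hz
  | h_outer => exact fun z hz => outer_mul_mem_tail hT hz
  | h_gen v => exact fun z hz => gen_left_mul_mem_tail v hz
  | add x y hx hy =>
    intro z hz
    rw [add_mul]
    exact Submodule.add_mem _ (hx z hz) (hy z hz)
  | mul x y hx hy =>
    intro z hz
    rw [mul_assoc]
    exact hx _ (hy z hz)

/-- The blocks of `B A + A Bᵀ`. -/
noncomputable def lyapunov (B : (c : Blk a) → Matrix c.Pos c.Pos F) (A : Module.End F (VSp a)) (c d : Blk a) :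
    Matrix c.Pos d.Pos F :=
  B c * block A c d + block A c d * (B d)ᵀ

theorem lyapunov_symm {A : Module.End F (VSp a)} (hA : IsSymm A) (c d : Blk a) :
    (lyapunov B A c d)ᵀ = lyapunov B A d c := by
  have h : (block A c d)ᵀ = block A d c := by
    ext s t
    exact hA _ _
  rw [lyapunov, lyapunov, Matrix.transpose_add, Matrix.transpose_mul, Matrix.transpose_mul, h,
    Matrix.transpose_transpose, add_comm]

/-- `T` acts on each factor within its own block, so a pair of blocks is closed under the
commutator; transferring `T` from the basis vectors to the coefficients gives `B` on the left and
`Bᵀ` on the right. -/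
theorem sum_block_comm (hT : HasBlocks T b B) (A : Module.End F (VSp a)) (c d : Blk a) :
    ∑ s : c.Pos, ∑ t : d.Pos, entry A ⟨c, s⟩ ⟨d, t⟩ •
        (outer T * quadMon T b (⟨c, s⟩, ⟨d, t⟩) - quadMon T b (⟨c, s⟩, ⟨d, t⟩) * outer T) =
      ∑ s : c.Pos, ∑ t : d.Pos, lyapunov B A c d s t • quadMon T b (⟨c, s⟩, ⟨d, t⟩) := by
  simp only [outer_comm_quadMon, gen_apply_basis hT, Finset.sum_mul, Finset.mul_sum,
    smul_mul_assoc, mul_smul_comm, lyapunov, Matrix.add_apply, Matrix.mul_apply,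
    Matrix.transpose_apply, smul_add, add_smul, Finset.sum_add_distrib, Finset.smul_sum,
    Finset.sum_smul, smul_smul]
  congr 1
  · rw [Finset.sum_comm' (t' := Finset.univ) (s' := fun _ => Finset.univ) (by simp)]
    conv_rhs => rw [Finset.sum_comm' (t' := Finset.univ) (s' := fun _ => Finset.univ) (by simp)]
    refine Finset.sum_congr rfl fun t _ => ?_
    rw [Finset.sum_comm' (t' := Finset.univ) (s' := fun _ => Finset.univ) (by simp)]
    refine Finset.sum_congr rfl fun s _ => Finset.sum_congr rfl fun r _ => ?_
    rw [mul_comm]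
    rfl
  · refine Finset.sum_congr rfl fun s _ => ?_
    rw [Finset.sum_comm' (t' := Finset.univ) (s' := fun _ => Finset.univ) (by simp)]
    rfl

theorem sum_blkLabels {M : Type*} [AddCommMonoid M] (E : Finset (Blk a))
    (f : Idx a × Idx a → M) :
    ∑ ij ∈ blkLabels E ×ˢ blkLabels E, f ij =
      ∑ c ∈ E, ∑ d ∈ E, ∑ s : c.Pos, ∑ t : d.Pos, f (⟨c, s⟩, ⟨d, t⟩) := by
  rw [Finset.sum_product, blkLabels, Finset.sum_sigma]
  refine Finset.sum_congr rfl fun c _ => ?_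
  rw [Finset.sum_comm]
  simp only [Finset.sum_sigma]
  exact Finset.sum_congr rfl fun d _ => Finset.sum_comm

theorem sum_comm_quadMon (hT : HasBlocks T b B) (A : Module.End F (VSp a)) (E : Finset (Blk a)) :
    ∑ ij ∈ blkLabels E ×ˢ blkLabels E, entry A ij.1 ij.2 •
        (outer T * quadMon T b ij - quadMon T b ij * outer T) =
      ∑ ij ∈ blkLabels E ×ˢ blkLabels E,
        lyapunov B A ij.1.1 ij.2.1 ij.1.2 ij.2.2 • quadMon T b ij := by
  rw [sum_blkLabels, sum_blkLabels]
  exact Finset.sum_congr rfl fun c _ => Finset.sum_congr rfl fun d _ => sum_block_comm hT A c d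

theorem outer_comm_mem_tail (hT : HasBlocks T b B) {E : Finset (Blk a)} {ij : Idx a × Idx a}
    (h : ij ∉ blkLabels E ×ˢ blkLabels E) :
    outer T * quadMon T b ij - quadMon T b ij * outer T ∈ tail T b (blkLabels E) := by
  rw [outer_comm_quadMon]
  rw [Finset.mem_product, not_and_or] at h
  rcases h with h | h
  · exact Submodule.add_mem _ (gen_apply_mul_mem_tail hT (fun h' => h (mem_blkLabels.2 h')) _)
      (gen_mul_mem_tail T b h _)
  · rw [gen_mul_comm T (T (b ij.1)), gen_mul_comm T (b ij.1)]
    exact Submodule.add_mem _ (gen_mul_mem_tail T b h _)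
      (gen_apply_mul_mem_tail hT (fun h' => h (mem_blkLabels.2 h')) _)

theorem formallyCentral_of_lyapunov_eq_zero (hT : HasBlocks T b B) {A : Module.End F (VSp a)}
    (hA : ∀ c d, lyapunov B A c d = 0) : FormallyCentral T b A := by
  classical
  have key : ∀ w : UniversalEnvelopingAlgebra F (AlmostAbelian T), ∀ E : Finset (Blk a),
      ∃ K₀ : Finset (Idx a × Idx a), ∀ K : Finset (Idx a × Idx a), K₀ ⊆ K →
        ∑ ij ∈ K, entry A ij.1 ij.2 • (w * quadMon T b ij - quadMon T b ij * w) ∈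
          tail T b (blkLabels E) := by
    intro w E
    induction w using enveloping_induction with
    | scalar c =>
      refine ⟨∅, fun K _ => ?_⟩
      simp only [Algebra.commutes, sub_self, smul_zero, Finset.sum_const_zero]
      exact Submodule.zero_mem _
    | h_outer =>
      -- Inside these complete blocks the commutators cancel exactly; every further term has a
      -- factor outside `E` and is small by itself.
      refine ⟨blkLabels E ×ˢ blkLabels E, fun K hK => ?_⟩
      rw [← Finset.sum_sdiff hK, sum_comm_quadMon hT]
      simp only [hA, Matrix.zero_apply, zero_smul, Finset.sum_const_zero, add_zero]
      refine Submodule.sum_mem _ fun ij hij => Submodule.smul_mem _ _ ?_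
      exact outer_comm_mem_tail hT (Finset.mem_sdiff.1 hij).2
    | h_gen v =>
      refine ⟨∅, fun K _ => ?_⟩
      simp only [gen_mul_quadMon, sub_self, smul_zero, Finset.sum_const_zero]
      exact Submodule.zero_mem _
    | add x y hx hy =>
      obtain ⟨K₁, h1⟩ := hx
      obtain ⟨K₂, h2⟩ := hy
      refine ⟨K₁ ∪ K₂, fun K hK => ?_⟩
      have h := Submodule.add_mem _ (h1 K (Finset.union_subset_left hK))
        (h2 K (Finset.union_subset_right hK))
      rw [← Finset.sum_add_distrib] at h
      convert h using 3
      rw [← smul_add]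
      congr 1
      noncomm_ring
    | mul x y hx hy =>
      obtain ⟨K₁, h1⟩ := hx
      obtain ⟨K₂, h2⟩ := hy
      refine ⟨K₁ ∪ K₂, fun K hK => ?_⟩
      -- Here `[x y, q] = [x, q] y + x [y, q]` is used, with smallness preserved by multiplication
      -- on either side.
      have h := Submodule.add_mem _
        (mul_mem_tail T b (h1 K (Finset.union_subset_left hK)) y)
        (left_mul_mem_tail hT E x _ (h2 K (Finset.union_subset_right hK)))
      rw [Finset.sum_mul, Finset.mul_sum, ← Finset.sum_add_distrib] at h
      convert h using 3
      rw [smul_mul_assoc, mul_smul_comm, ← smul_add]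
      congr 1
      noncomm_ring
  intro w S
  obtain ⟨E, hE⟩ := exists_subset_blkLabels S
  obtain ⟨K₀, h⟩ := key w E
  exact ⟨K₀, fun K hK => tail_anti hE (h K hK)⟩

theorem lyapunov_eq_zero_of_formallyCentral (h2 : (2 : F) ≠ 0) (hT : HasBlocks T b B)
    {A : Module.End F (VSp a)} (hA : IsSymm A) (h : FormallyCentral T b A) (c d : Blk a) :
    lyapunov B A c d = 0 := by
  classical
  ext s t
  obtain ⟨K₀, hK₀⟩ := h (outer T) {⟨c, s⟩, ⟨d, t⟩}
  -- The finite set is enlarged to complete blocks, where the sum of commutators has the closed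
  -- form, and is made to contain the coefficient under study.
  obtain ⟨E, hE⟩ := exists_subset_blkLabels_prod (insert (⟨c, s⟩, ⟨d, t⟩) K₀)
  have hmem := hE (Finset.mem_insert_self _ _)
  rw [Finset.mem_product] at hmem
  have hz := hessian_eq_zero_of_mem_tail T b (k := ⟨c, s⟩) (l := ⟨d, t⟩) (by simp) (by simp)
    (hK₀ _ ((Finset.subset_insert _ _).trans hE))
  rw [sum_comm_quadMon hT, map_sum] at hz
  simp only [map_smul, smul_eq_mul] at hz
  -- Written as a sum of two indicators, the formula also covers equal labels, where both indicators
  -- pick the same term.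
  have hsplit : ∀ ij : Idx a × Idx a, hessian T b ⟨c, s⟩ ⟨d, t⟩ (quadMon T b ij) =
      (if ij = (⟨c, s⟩, ⟨d, t⟩) then 1 else 0) + (if ij = (⟨d, t⟩, ⟨c, s⟩) then 1 else 0) := by
    rintro ⟨i, j⟩
    rw [hessian_quadMon]
    simp only [Prod.mk.injEq]
  simp only [hsplit, mul_add, mul_ite, mul_one, mul_zero, Finset.sum_add_distrib,
    Finset.sum_ite_eq'] at hz
  rw [if_pos (Finset.mem_product.2 hmem), if_pos (Finset.mem_product.2 hmem.symm)] at hz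
  have hs : lyapunov B A d c t s = lyapunov B A c d s t := by
    rw [← lyapunov_symm hA c d, Matrix.transpose_apply]
  rw [hs, ← two_mul] at hz
  exact (mul_eq_zero.1 hz).resolve_left h2

theorem finsum_quadMon_eq {A : Module.End F (VSp a)} {K : Finset (Idx a × Idx a)}
    (hK : ∀ ij, entry A ij.1 ij.2 ≠ 0 → ij ∈ K) :
    ∑ᶠ ij : Idx a × Idx a, entry A ij.1 ij.2 • quadMon T b ij =
      ∑ ij ∈ K, entry A ij.1 ij.2 • quadMon T b ij := by
  refine finsum_eq_sum_of_support_subset _ fun ij hij => hK ij fun h0 => hij ?_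
  change entry A ij.1 ij.2 • quadMon T b ij = 0
  rw [h0, zero_smul]

/-- Once the finite set contains the support, the sum of commutators is the actual commutator, which
is zero. -/
theorem formallyCentral_of_mem_center {A : Module.End F (VSp a)}
    (hfin : {ij : Idx a × Idx a | entry A ij.1 ij.2 ≠ 0}.Finite)
    (hQ : ∑ᶠ ij : Idx a × Idx a, entry A ij.1 ij.2 • quadMon T b ij ∈
      Subalgebra.center F (UniversalEnvelopingAlgebra F (AlmostAbelian T))) :
    FormallyCentral T b A := by
  intro w S
  refine ⟨hfin.toFinset, fun K hK => ?_⟩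
  rw [finsum_quadMon_eq (K := K) (fun ij hij => hK (hfin.mem_toFinset.2 hij)),
    Subalgebra.mem_center_iff] at hQ
  have h := hQ w
  rw [Finset.mul_sum, Finset.sum_mul, ← sub_eq_zero, ← Finset.sum_sub_distrib] at h
  simp only [mul_smul_comm, smul_mul_assoc, ← smul_sub] at h
  rw [h]
  exact Submodule.zero_mem _

/-- The finite support fits into finitely many complete blocks, where the commutator with `e₀`
vanishes exactly; no separation property of the topology is needed. -/
theorem mem_center_of_lyapunov_eq_zero (hT : HasBlocks T b B) {A : Module.End F (VSp a)}
    (hfin : {ij : Idx a × Idx a | entry A ij.1 ij.2 ≠ 0}.Finite)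
    (hA : ∀ c d, lyapunov B A c d = 0) :
    ∑ᶠ ij : Idx a × Idx a, entry A ij.1 ij.2 • quadMon T b ij ∈
      Subalgebra.center F (UniversalEnvelopingAlgebra F (AlmostAbelian T)) := by
  obtain ⟨E, hE⟩ := exists_subset_blkLabels_prod hfin.toFinset
  rw [finsum_quadMon_eq (fun ij hij => hE (hfin.mem_toFinset.2 hij)), Subalgebra.mem_center_iff]
  intro w
  induction w using enveloping_induction with
  | scalar c => exact Algebra.commutes _ _
  | h_outer =>
    have h := sum_comm_quadMon hT A E
    simp only [hA, Matrix.zero_apply, zero_smul, Finset.sum_const_zero, smul_sub,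
      Finset.sum_sub_distrib, sub_eq_zero] at h
    simpa only [Finset.mul_sum, Finset.sum_mul, mul_smul_comm, smul_mul_assoc] using h
  | h_gen v =>
    simp only [Finset.mul_sum, Finset.sum_mul, mul_smul_comm, smul_mul_assoc, gen_mul_quadMon]
  | add x y hx hy => rw [add_mul, mul_add, hx, hy]
  | mul x y hx hy => rw [mul_assoc, hy, ← mul_assoc, hx, mul_assoc]

theorem exists_symm_of_mem_span (h2 : (2 : F) ≠ 0)
    {Q : UniversalEnvelopingAlgebra F (AlmostAbelian T)}
    (hQ : Q ∈ Submodule.span F (Set.range (quadMon T b))) :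
    ∃ A : Module.End F (VSp a), IsSymm A ∧
      {ij : Idx a × Idx a | entry A ij.1 ij.2 ≠ 0}.Finite ∧
      Q = ∑ᶠ ij : Idx a × Idx a, entry A ij.1 ij.2 • quadMon T b ij := by
  classical
  obtain ⟨r, rfl⟩ := (Finsupp.mem_span_range_iff_exists_finsupp).1 hQ
  -- Since the `x_i` commute, symmetrising the coefficients leaves the element unchanged; `K` is the
  -- support made stable under swapping.
  let g : Idx a → Idx a → F := fun i j => 2⁻¹ * (r (i, j) + r (j, i))
  let K : Finset (Idx a × Idx a) := r.support ∪ r.support.map (Equiv.prodComm _ _).toEmbedding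
  have hK : ∀ i j, g i j ≠ 0 → (i, j) ∈ K := by
    intro i j h
    by_contra hn
    simp only [K, Finset.mem_union, Finsupp.mem_support_iff, Finset.mem_map_equiv, not_or,
      not_not] at hn
    apply h
    simp only [g, hn.1]
    have h' : r (j, i) = 0 := hn.2
    rw [h', add_zero, mul_zero]
  let A : Module.End F (VSp a) := Finsupp.linearCombination F fun j : Idx a =>
    Finsupp.onFinset (K.image Prod.fst) (fun i => g i j)
      fun i h => Finset.mem_image.2 ⟨(i, j), hK i j h, rfl⟩
  have hent : ∀ i j, entry A i j = g i j := fun i j => by simp [entry, A]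
  refine ⟨A, fun i j => ?_, ?_, ?_⟩
  · rw [hent, hent]
    simp only [g, add_comm]
  · refine K.finite_toSet.subset fun ij h => ?_
    exact hK ij.1 ij.2 (by rw [← hent]; exact h)
  · rw [finsum_quadMon_eq (K := K) (fun ij h => hK ij.1 ij.2 (by rw [← hent]; exact h))]
    have hsym : ∀ ij : Idx a × Idx a, ij ∈ K ↔ ij.swap ∈ K := by
      rintro ⟨i, j⟩
      simp only [K, Finset.mem_union, Finset.mem_map_equiv]
      exact or_comm
    have hswap : ∑ ij ∈ K, r ij.swap • quadMon T b ij = ∑ ij ∈ K, r ij • quadMon T b ij := by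
      refine Finset.sum_bij' (fun ij _ => ij.swap) (fun ij _ => ij.swap)
        (fun ij h => (hsym ij).1 h) (fun ij h => (hsym ij).1 h) (fun _ _ => rfl)
        (fun _ _ => rfl) ?_
      rintro ⟨i, j⟩ _
      rw [Prod.swap_prod_mk, quadMon_swap]
    have hsum : (r.sum fun ij c => c • quadMon T b ij) = ∑ ij ∈ K, r ij • quadMon T b ij :=
      Finsupp.sum_of_support_subset _ Finset.subset_union_left _ (by simp)
    rw [hsum]
    have hg : ∀ ij : Idx a × Idx a, entry A ij.1 ij.2 • quadMon T b ij =
        (2⁻¹ : F) • (r ij • quadMon T b ij + r ij.swap • quadMon T b ij) := by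
      rintro ⟨i, j⟩
      rw [hent, ← add_smul, smul_smul]
      rfl
    simp only [hg]
    rw [← Finset.smul_sum, Finset.sum_add_distrib, hswap, ← two_smul F, smul_smul,
      inv_mul_cancel₀ h2, one_smul]

theorem describesCasimirs_of_hasBlocks (h2 : (2 : F) ≠ 0) (hT : HasBlocks T b B)
    {P : Module.End F (VSp a) → Prop} (hP : ∀ A, P A ↔ ∀ c d, lyapunov B A c d = 0) :
    DescribesCasimirs T b P := by
  refine ⟨fun A hA => ?_, fun Q => ⟨?_, ?_⟩⟩
  · rw [hP]
    exact ⟨lyapunov_eq_zero_of_formallyCentral h2 hT hA, formallyCentral_of_lyapunov_eq_zero hT⟩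
  · rintro ⟨hspan, hcen⟩
    obtain ⟨A, hA, hfin, rfl⟩ := exists_symm_of_mem_span h2 hspan
    exact ⟨A, hA, hfin, (hP A).2 (lyapunov_eq_zero_of_formallyCentral h2 hT hA
      (formallyCentral_of_mem_center hfin hcen)), rfl⟩
  · rintro ⟨A, hA, hfin, hPA, rfl⟩
    refine ⟨?_, mem_center_of_lyapunov_eq_zero hT hfin ((hP A).1 hPA)⟩
    rw [finsum_quadMon_eq (fun ij hij => hfin.mem_toFinset.2 hij)]
    exact Submodule.sum_mem _ fun ij _ => Submodule.smul_mem _ _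
      (Submodule.subset_span ⟨ij, rfl⟩)

end Quadratic

/-! ## The Casimir conditions -/

section RingIdentities

variable {E : Type*} [Ring E] {J J' Jt W Wi V A : E}

theorem mul_eq_neg_of_mul_eq_neg (hV : V * V = 1) (hVJ : V * J' = -(J * V)) :
    J' * V = -(V * J) := by
  calc J' * V = (V * V) * J' * V := by rw [hV, one_mul]
    _ = -(V * J * (V * V)) := by rw [mul_assoc V V, hVJ]; noncomm_ring
    _ = _ := by rw [hV, mul_one]

theorem inv_mul_eq_of_mul_eq (hW : W * Wi = 1) (hW' : Wi * W = 1) (hWJ : W * J = Jt * W) :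
    J * Wi = Wi * Jt := by
  calc J * Wi = (Wi * W) * J * Wi := by rw [hW', one_mul]
    _ = Wi * (Jt * W) * Wi := by rw [← hWJ]; noncomm_ring
    _ = _ := by rw [mul_assoc, mul_assoc, hW, mul_one]

/-- The factorisation forces `C = V W⁻¹ A`; moving `J` through `A`, `W⁻¹` and `V` produces two
signs, which cancel. -/
theorem exists_eq_mul_mul_iff (hW : W * Wi = 1) (hW' : Wi * W = 1) (hWJ : W * J = Jt * W)
    (hV : V * V = 1) (hVJ : V * J' = -(J * V)) :
    (∃ C, C * J = J' * C ∧ A = W * (V * C)) ↔ Jt * A + A * J = 0 := by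
  constructor
  · rintro ⟨C, hC, rfl⟩
    calc Jt * (W * (V * C)) + W * (V * C) * J = (Jt * W) * V * C + W * V * (C * J) := by
          noncomm_ring
      _ = W * J * V * C + W * (V * J') * C := by rw [hC, hWJ]; noncomm_ring
      _ = 0 := by rw [hVJ]; noncomm_ring
  · intro h
    have h1 : A * J = -(Jt * A) := eq_neg_of_add_eq_zero_right h
    refine ⟨V * (Wi * A), ?_, ?_⟩
    · calc V * (Wi * A) * J = V * Wi * (A * J) := by noncomm_ring
        _ = -(V * (Wi * Jt) * A) := by rw [h1]; noncomm_ring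
        _ = -(V * J) * (Wi * A) := by
          rw [← inv_mul_eq_of_mul_eq hW hW' hWJ]; noncomm_ring
        _ = _ := by rw [← mul_eq_neg_of_mul_eq_neg hV hVJ, mul_assoc]
    · rw [← mul_assoc V V, hV, one_mul, ← mul_assoc, hW, one_mul]

/-- Here `C = V A W` is forced. Conversely the identity is first obtained after right multiplication
by `W`, which is then cancelled. -/
theorem exists_mul_eq_mul_iff (hW : W * Wi = 1) (hWJ : W * J = Jt * W)
    (hV : V * V = 1) (hVJ : V * J' = -(J * V)) :
    (∃ C, C * J = J' * C ∧ A * W = V * C) ↔ J * A + A * Jt = 0 := by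
  constructor
  · rintro ⟨C, hC, hA⟩
    have h : (J * A + A * Jt) * W = 0 := by
      calc (J * A + A * Jt) * W = J * (A * W) + A * (Jt * W) := by noncomm_ring
        _ = J * (A * W) + (A * W) * J := by rw [← hWJ]; noncomm_ring
        _ = J * V * C + V * (C * J) := by rw [hA]; noncomm_ring
        _ = J * V * C + (V * J') * C := by rw [hC]; noncomm_ring
        _ = 0 := by rw [hVJ]; noncomm_ring
    calc J * A + A * Jt = (J * A + A * Jt) * (W * Wi) := by rw [hW, mul_one]
      _ = 0 := by rw [← mul_assoc, h, zero_mul]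
  · intro h
    have h1 : A * Jt = -(J * A) := eq_neg_of_add_eq_zero_right h
    refine ⟨V * (A * W), ?_, ?_⟩
    · calc V * (A * W) * J = V * A * (W * J) := by noncomm_ring
        _ = V * (A * Jt) * W := by rw [hWJ]; noncomm_ring
        _ = -(V * J) * (A * W) := by rw [h1]; noncomm_ring
        _ = _ := by rw [← mul_eq_neg_of_mul_eq_neg hV hVJ, mul_assoc]
    · rw [← mul_assoc V, hV, one_mul]

end RingIdentities

/-! ### The factorisations by `W(ℵ)` and `V(-1; ℵ)` as equations for `A` -/

section Conditions

variable {F : Type u} [Field F] (R : MatRep F) (a : MultFun.{u, v} F)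

/-- The blockwise transpose of `J(ℵ)`. -/
noncomputable def jordanT : Module.End F (VSp a) :=
  blockDiag fun b => (jordanMat R b.p.1 b.n b.p.deg)ᵀ

/-- The inverse of `W(ℵ)`. -/
noncomputable def wInv : Module.End F (VSp a) :=
  blockDiag fun b => (antiMat F b.n ⊗ₖ wMat R.eps b.p.1 b.p.deg)⁻¹

theorem isUnit_det_wBlock (b : Blk a) :
    IsUnit (antiMat F b.n ⊗ₖ wMat R.eps b.p.1 b.p.deg).det :=
  (Matrix.isUnit_iff_isUnit_det _).1 (isUnit_wBlock R _ _ _)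

theorem wOp_mul_wInv : wOp R a * wInv R a = 1 := by
  rw [wOp, wInv, Module.End.mul_eq_comp, blockDiag_comp]
  simp only [Matrix.mul_nonsing_inv _ (isUnit_det_wBlock R a _)]
  exact blockDiag_one

theorem wInv_mul_wOp : wInv R a * wOp R a = 1 := by
  rw [wOp, wInv, Module.End.mul_eq_comp, blockDiag_comp]
  simp only [Matrix.nonsing_inv_mul _ (isUnit_det_wBlock R a _)]
  exact blockDiag_one

theorem vOp_mul_self : (vOp a * vOp a : Module.End F (VSp a)) = 1 := by
  rw [vOp, Module.End.mul_eq_comp, blockDiag_comp]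
  simp only [vBlock_mul_self]
  exact blockDiag_one

theorem wOp_mul_jordan : wOp R a * jordan R a = jordanT R a * wOp R a := by
  simp only [wOp, jordan, jordanT, Module.End.mul_eq_comp, blockDiag_comp]
  congr 1
  funext b
  exact wBlock_mul_jordanMat R b.p.2.2 rfl

theorem blockDiag_neg (B : (b : Blk a) → Matrix b.Pos b.Pos F) :
    (blockDiag fun b => -B b) = -blockDiag B := by
  refine LinearMap.ext fun v => Finsupp.ext fun ⟨b, s⟩ => ?_
  rw [LinearMap.neg_apply, Finsupp.neg_apply, blockDiag_apply, blockDiag_apply]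
  simp only [Matrix.neg_apply, neg_mul, Finset.sum_neg_distrib]

theorem vOp_mul_jordanDil : vOp a * jordanDil R (-1) a = -(jordan R a * vOp a) := by
  simp only [vOp, jordanDil, jordan, Module.End.mul_eq_comp, blockDiag_comp]
  rw [← blockDiag_neg]
  congr 1
  funext b
  exact vBlock_mul_jordanMat_dil R b.p.2.2 rfl

theorem block_add (A B : Module.End F (VSp a)) (b c : Blk a) :
    block (A + B) b c = block A b c + block B b c := rfl

theorem lyapunov_eq_zero_iff (B : (c : Blk a) → Matrix c.Pos c.Pos F) (A : Module.End F (VSp a)) :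
    (∀ c d, lyapunov B A c d = 0) ↔ blockDiag B * A + A * (blockDiag fun c => (B c)ᵀ) = 0 := by
  have h : ∀ c d, block (blockDiag B * A + A * (blockDiag fun c => (B c)ᵀ)) c d =
      lyapunov B A c d := fun c d => by
    rw [block_add, Module.End.mul_eq_comp, Module.End.mul_eq_comp, block_comp_blockDiag,
      block_blockDiag_comp, lyapunov]
  constructor
  · intro h0
    refine block_ext fun c d => ?_
    rw [h, h0]
    rfl
  · intro h0 c d
    rw [← h, h0]
    rfl

theorem wOp_vOp_factor_iff (A : Module.End F (VSp a)) :
    (∃ C : Module.End F (VSp a), IsIntertwiner (jordan R a) (jordanDil R (-1) a) C ∧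
      A = wOp R a ∘ₗ vOp a ∘ₗ C) ↔ jordanT R a * A + A * jordan R a = 0 := by
  have h := exists_eq_mul_mul_iff (A := A) (wOp_mul_wInv R a) (wInv_mul_wOp R a) (wOp_mul_jordan R a)
    (vOp_mul_self a) (vOp_mul_jordanDil R a)
  exact h

theorem mul_wOp_factor_iff (A : Module.End F (VSp a)) :
    (∃ C : Module.End F (VSp a), IsIntertwiner (jordan R a) (jordanDil R (-1) a) C ∧
      A ∘ₗ wOp R a = vOp a ∘ₗ C) ↔ jordan R a * A + A * jordanT R a = 0 := by
  have h := exists_mul_eq_mul_iff (A := A) (wOp_mul_wInv R a) (wOp_mul_jordan R a)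
    (vOp_mul_self a) (vOp_mul_jordanDil R a)
  exact h

/-- The column convention is the transpose of the matrix of an operator, so the two conditions agree
by definition. -/
theorem hasBlocks_of_isColumnAdapted {b : Module.Basis (Idx a) F (VSp a)}
    (hb : IsColumnAdapted R b) :
    HasBlocks (jordan R a) b fun c => (jordanMat R c.p.1 c.n c.p.deg)ᵀ := hb

theorem hasBlocks_basisSingleOne :
    HasBlocks (jordan R a) Finsupp.basisSingleOne fun c => jordanMat R c.p.1 c.n c.p.deg := by
  intro c s
  simp only [Finsupp.coe_basisSingleOne]
  exact blockDiag_single _ _ _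

/-- The columns of `W⁻¹` form such a basis, because `J W⁻¹ = W⁻¹ Jᵀ`. -/
theorem exists_isColumnAdapted :
    ∃ b : Module.Basis (Idx a) F (VSp a), IsColumnAdapted R b := by
  let e : VSp a ≃ₗ[F] VSp a :=
    LinearEquiv.ofLinearMap (wInv R a) (wOp R a) (wInv_mul_wOp R a) (wOp_mul_wInv R a)
  have he : ∀ i, (Finsupp.basisSingleOne.map e) i = wInv R a (Finsupp.single i 1) := fun i => by
    simp [e]
  refine ⟨Finsupp.basisSingleOne.map e, fun c s => ?_⟩
  simp only [he]
  have h3 : jordan R a * wInv R a = wInv R a * jordanT R a := by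
    have h := inv_mul_eq_of_mul_eq (E := Module.End F (VSp a)) (wOp_mul_wInv R a)
      (wInv_mul_wOp R a) (wOp_mul_jordan R a)
    exact h
  have h4 := LinearMap.congr_fun h3 (Finsupp.single (⟨c, s⟩ : Idx a) (1 : F))
  rw [Module.End.mul_apply, Module.End.mul_apply, jordanT, blockDiag_single, map_sum] at h4
  rw [h4]
  simp only [map_smul, Matrix.transpose_apply]

end Conditions

/-! ## Polynomials in a matrix annihilated by an irreducible polynomial -/

section Annihilated

variable {F : Type u} [Field F]

theorem isUnit_aeval_of_isCoprime {A : Type*} [Ring A] [Algebra F A] {x : A} {P Q : F[X]}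
    (hx : aeval x P = 0) (h : IsCoprime P Q) : IsUnit (aeval x Q) := by
  obtain ⟨r, s, hrs⟩ := h
  have h1 := congrArg (aeval x) hrs
  rw [map_add, map_mul, map_mul, hx, mul_zero, zero_add, map_one] at h1
  have h2 : aeval x Q * aeval x s = 1 := by rw [← map_mul, mul_comm, map_mul, h1]
  exact ⟨⟨_, _, h2, h1⟩, rfl⟩

/-- When `[x, z]` commutes with `x`, the bracket with `z` acts on polynomials in `x` like a
derivation. -/
theorem aeval_mul_sub_mul_aeval {A : Type*} [Ring A] [Algebra F A] {x y z : A}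
    (hy : x * z - z * x = y) (hxy : x * y = y * x) (f : F[X]) :
    aeval x f * z - z * aeval x f = aeval x (derivative f) * y := by
  induction f using Polynomial.induction_on' with
  | add p q hp hq =>
    simp only [map_add, add_mul, mul_add, ← hp, ← hq]
    abel
  | monomial n c =>
    have h : ∀ n : ℕ, x ^ n * z - z * x ^ n = n • (x ^ (n - 1) * y) := by
      intro n
      induction n with
      | zero => simp
      | succ n ih =>
        have hc : y * x ^ n = x ^ n * y :=
          ((show Commute x y from hxy).pow_left n).eq.symm
        calc x ^ (n + 1) * z - z * x ^ (n + 1)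
            = x * (x ^ n * z - z * x ^ n) + (x * z - z * x) * x ^ n := by
              rw [pow_succ']; noncomm_ring
          _ = n • (x * x ^ (n - 1) * y) + x ^ n * y := by
              rw [ih, hy, hc, mul_smul_comm, mul_assoc]
          _ = (n + 1) • (x ^ n * y) := by
              rcases n with _ | n
              · simp
              · rw [Nat.add_sub_cancel, ← pow_succ', succ_nsmul _ (n + 1)]
    rw [derivative_monomial, aeval_monomial, aeval_monomial, mul_assoc, ← mul_assoc z,
      ← Algebra.commutes c z, mul_assoc, ← mul_sub, h, map_mul, map_natCast, mul_assoc,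
      mul_assoc, nsmul_eq_mul]

/-- Applied to `P`, the derivation rule gives `P'(x) y = 0`, and separability makes `P'(x)`
invertible. -/
theorem eq_zero_of_commutator {A : Type*} [Ring A] [Algebra F A] {x y z : A} {P : F[X]}
    (hx : aeval x P = 0) (hP : P.Separable) (hy : x * z - z * x = y) (hxy : x * y = y * x) :
    y = 0 := by
  have h := aeval_mul_sub_mul_aeval hy hxy P
  rw [hx, zero_mul, mul_zero, sub_zero] at h
  exact (isUnit_aeval_of_isCoprime hx hP).mul_right_eq_zero.1 h.symm

theorem aeval_mul_of_intertwine {d d' : ℕ} {x : Matrix (Fin d) (Fin d) F}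
    {x' : Matrix (Fin d') (Fin d') F} {Y : Matrix (Fin d') (Fin d) F} (h : Y * x = x' * Y)
    (f : F[X]) : Y * aeval x f = aeval x' f * Y := by
  induction f using Polynomial.induction_on' with
  | add p q hp hq => rw [map_add, map_add, Matrix.mul_add, Matrix.add_mul, hp, hq]
  | monomial n c =>
    have hn : Y * x ^ n = x' ^ n * Y := by
      induction n with
      | zero => rw [pow_zero, pow_zero, Matrix.mul_one, Matrix.one_mul]
      | succ n ih => rw [pow_succ, ← Matrix.mul_assoc, ih, Matrix.mul_assoc, h, pow_succ,
          Matrix.mul_assoc]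
    rw [aeval_monomial, aeval_monomial, ← Algebra.smul_def, ← Algebra.smul_def, Matrix.mul_smul,
      Matrix.smul_mul, hn]

theorem eq_zero_of_intertwine {d d' : ℕ} {x : Matrix (Fin d) (Fin d) F}
    {x' : Matrix (Fin d') (Fin d') F} {Y : Matrix (Fin d') (Fin d) F} {P P' : F[X]}
    (hx : aeval x P = 0) (hx' : aeval x' P' = 0) (hPP : IsCoprime P' P) (h : Y * x = x' * Y) :
    Y = 0 := by
  have h1 := aeval_mul_of_intertwine h P
  rw [hx, Matrix.mul_zero] at h1
  obtain ⟨w, hw⟩ := isUnit_aeval_of_isCoprime hx' hPP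
  rw [← hw] at h1
  calc Y = (↑w⁻¹ * ↑w : Matrix (Fin d') (Fin d') F) * Y := by
        rw [Units.inv_mul, Matrix.one_mul]
    _ = 0 := by rw [Matrix.mul_assoc, ← h1, Matrix.mul_zero]

/-- A matrix of size `deg P` annihilated by an irreducible `P` has the polynomials in it as its
commutant. -/
theorem mem_adjoin_of_commute {d : ℕ} {x Y : Matrix (Fin d) (Fin d) F} {P : F[X]}
    (hP : Irreducible P) (hd : P.natDegree = d) (hx : aeval x P = 0) (h : Y * x = x * Y) :
    Y ∈ Algebra.adjoin F {x} := by
  have hpos : 0 < d := hd ▸ hP.natDegree_pos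
  set v : Fin d → F := Pi.single ⟨0, hpos⟩ 1 with hv
  have hv0 : v ≠ 0 := by
    intro h0
    have := congrFun h0 ⟨0, hpos⟩
    simp [hv] at this
  let φ : degreeLT F d →ₗ[F] (Fin d → F) :=
    { toFun := fun f => aeval x (f : F[X]) *ᵥ v
      map_add' := fun f g => by simp [Matrix.add_mulVec]
      map_smul' := fun c f => by simp [Matrix.smul_mulVec] }
  -- A nonzero `f` of degree below `d` is coprime to `P`, so `f(x)` is invertible and cannot kill
  -- `v`. By dimension, `v` is then cyclic, and a matrix commuting with `x` is determined by its
  -- value on `v`.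
  have hinj : Function.Injective φ := by
    rw [← LinearMap.ker_eq_bot, LinearMap.ker_eq_bot']
    intro f hf
    by_contra hf0
    have hf0' : (f : F[X]) ≠ 0 := fun h0 => hf0 (Subtype.ext h0)
    have hdeg : (f : F[X]).natDegree < P.natDegree := by
      rw [hd, natDegree_lt_iff_degree_lt hf0']
      exact mem_degreeLT.1 f.2
    have hcop : IsCoprime P (f : F[X]) :=
      (hP.coprime_iff_not_dvd).2 fun hdvd => absurd (natDegree_le_of_dvd hdvd hf0') (by omega)
    obtain ⟨w, hw⟩ := isUnit_aeval_of_isCoprime hx hcop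
    have hf' : aeval x (f : F[X]) *ᵥ v = 0 := hf
    apply hv0
    calc v = (↑w⁻¹ * ↑w : Matrix (Fin d) (Fin d) F) *ᵥ v := by
          rw [Units.inv_mul, Matrix.one_mulVec]
      _ = 0 := by rw [← Matrix.mulVec_mulVec, hw, hf', Matrix.mulVec_zero]
  have hfin : Module.finrank F (degreeLT F d) = Module.finrank F (Fin d → F) :=
    (degreeLTEquiv F d).finrank_eq
  have : FiniteDimensional F (degreeLT F d) :=
    FiniteDimensional.of_injective φ hinj
  have hsurj : Function.Surjective φ :=
    (LinearMap.injective_iff_surjective_of_finrank_eq_finrank hfin).1 hinj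
  obtain ⟨f, hf⟩ := hsurj (Y *ᵥ v)
  have hf' : aeval x (f : F[X]) *ᵥ v = Y *ᵥ v := hf
  have hY : Y = aeval x (f : F[X]) := by
    apply Matrix.toLin'.injective
    refine LinearMap.ext fun w => ?_
    obtain ⟨g, rfl⟩ := hsurj w
    change Y *ᵥ (aeval x (g : F[X]) *ᵥ v) = aeval x (f : F[X]) *ᵥ (aeval x (g : F[X]) *ᵥ v)
    rw [Matrix.mulVec_mulVec, Matrix.mulVec_mulVec, aeval_mul_of_intertwine h, ← map_mul,
      mul_comm (f : F[X]), map_mul, ← Matrix.mulVec_mulVec, ← Matrix.mulVec_mulVec, hf']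
  rw [hY]
  exact aeval_mem_adjoin_singleton F x

theorem commute_of_mem_adjoin {A : Type*} [Ring A] [Algebra F A] {x y : A}
    (h : y ∈ Algebra.adjoin F {x}) : y * x = x * y := by
  rw [Algebra.adjoin_singleton_eq_range_aeval] at h
  obtain ⟨f, rfl⟩ := h
  have hc : aeval x f * x = x * aeval x f := by
    simpa only [map_mul, aeval_X] using congrArg (aeval x) (mul_comm f X)
  exact hc

end Annihilated

/-! ## Intertwiners of two Jordan blocks -/

section Toeplitz

variable {F : Type u} [Field F]

/-- The `d' × d` blocks of `X`, with the column index shifted by one and extended by zero. -/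
def subBlock {n m d d' : ℕ} (X : Matrix (Fin n × Fin d') (Fin m × Fin d) F) (i : ℕ) :
    ℕ → Matrix (Fin d') (Fin d) F
  | 0 => 0
  | j + 1 => fun s t => if h : i < n ∧ j < m then X (⟨i, h.1⟩, s) (⟨j, h.2⟩, t) else 0

variable {n m d d' : ℕ} (X : Matrix (Fin n × Fin d') (Fin m × Fin d) F)

theorem subBlock_zero (i : ℕ) : subBlock X i 0 = 0 := rfl

theorem subBlock_of_le {i : ℕ} (hi : n ≤ i) (j : ℕ) : subBlock X i j = 0 := by
  cases j with
  | zero => rfl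
  | succ j =>
    ext s t
    exact dif_neg fun h => absurd h.1 (by omega)

theorem subBlock_of_lt {j : ℕ} (hj : m < j) (i : ℕ) : subBlock X i j = 0 := by
  cases j with
  | zero => rfl
  | succ j =>
    ext s t
    exact dif_neg fun h => absurd h.2 (by omega)

theorem subBlock_apply (i : Fin n) (j : Fin m) (s : Fin d') (t : Fin d) :
    subBlock X i (j + 1) s t = X (i, s) (j, t) := dif_pos ⟨i.2, j.2⟩

theorem mul_jordanMat_apply (R : MatRep F) (P : F[X]) (i : Fin n) (j : Fin m) (s : Fin d')
    (t : Fin d) :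
    (X * jordanMat R P m d) (i, s) (j, t) =
      (subBlock X i (j + 1) * R.x P d + subBlock X i j) s t := by
  rw [Matrix.mul_apply, Fintype.sum_prod_type]
  simp only [jordanMat, Matrix.add_apply, Matrix.kroneckerMap_apply, mul_add,
    Finset.sum_add_distrib]
  congr 1
  · rw [Finset.sum_eq_single j]
    · simp only [Matrix.one_apply_eq, one_mul, Matrix.mul_apply, subBlock_apply]
    · intro k _ hk
      simp [Matrix.one_apply_ne hk]
    · simp
  · have h1 : ∀ k : Fin m, ∑ w : Fin d, X (i, s) (k, w) *
        (nilMat F m k j * (1 : Matrix (Fin d) (Fin d) F) w t) =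
        X (i, s) (k, t) * nilMat F m k j := by
      intro k
      rw [Finset.sum_eq_single t]
      · rw [Matrix.one_apply_eq, mul_one]
      · intro w _ hw
        rw [Matrix.one_apply_ne hw, mul_zero, mul_zero]
      · simp
    simp only [h1]
    obtain ⟨j, hj⟩ := j
    cases j with
    | zero =>
      rw [subBlock_zero]
      exact Finset.sum_eq_zero fun k _ => by simp [nilMat]
    | succ j =>
      rw [Finset.sum_eq_single ⟨j, by omega⟩]
      · rw [show nilMat F m ⟨j, by omega⟩ ⟨j + 1, hj⟩ = 1 from if_pos rfl, mul_one]
        exact (subBlock_apply X i ⟨j, by omega⟩ s t).symm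
      · intro k _ hk
        rw [show nilMat F m k ⟨j + 1, hj⟩ = 0 from if_neg fun h => hk (Fin.ext (by
          have h' : j + 1 = (k : ℕ) + 1 := h
          change (k : ℕ) = j
          omega)), mul_zero]
      · simp

theorem jordanMat_mul_apply (R : MatRep F) (P : F[X]) (i : Fin n) (j : Fin m) (s : Fin d')
    (t : Fin d) :
    (jordanMat R P n d' * X) (i, s) (j, t) =
      (R.x P d' * subBlock X i (j + 1) + subBlock X (i + 1) (j + 1)) s t := by
  rw [Matrix.mul_apply, Fintype.sum_prod_type]
  simp only [jordanMat, Matrix.add_apply, Matrix.kroneckerMap_apply, add_mul,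
    Finset.sum_add_distrib]
  congr 1
  · rw [Finset.sum_eq_single i]
    · simp only [Matrix.one_apply_eq, one_mul, Matrix.mul_apply, subBlock_apply]
    · intro k _ hk
      simp [Matrix.one_apply_ne hk.symm]
    · simp
  · have h1 : ∀ k : Fin n, ∑ w : Fin d', nilMat F n i k *
        (1 : Matrix (Fin d') (Fin d') F) s w * X (k, w) (j, t) =
        nilMat F n i k * X (k, s) (j, t) := by
      intro k
      rw [Finset.sum_eq_single s]
      · rw [Matrix.one_apply_eq, mul_one]
      · intro w _ hw
        rw [Matrix.one_apply_ne hw.symm, mul_zero, zero_mul]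
      · simp
    simp only [h1]
    by_cases hi : (i : ℕ) + 1 < n
    · rw [Finset.sum_eq_single ⟨i + 1, hi⟩]
      · rw [show nilMat F n i ⟨i + 1, hi⟩ = 1 from if_pos rfl, one_mul]
        exact (subBlock_apply X ⟨i + 1, hi⟩ j s t).symm
      · intro k _ hk
        rw [show nilMat F n i k = 0 from if_neg fun h => hk (Fin.ext h), zero_mul]
      · simp
    · rw [subBlock_of_le X (by omega)]
      refine Finset.sum_eq_zero fun k _ => ?_
      have hk := k.2
      rw [show nilMat F n i k = 0 from if_neg (by omega), zero_mul]

/-- The equations for the blocks of an intertwiner of two Jordan blocks. -/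
theorem mul_jordanMat_eq_iff (R : MatRep F) (P P' : F[X]) :
    X * jordanMat R P m d = jordanMat R P' n d' * X ↔
      ∀ i < n, ∀ j < m, subBlock X i (j + 1) * R.x P d + subBlock X i j =
        R.x P' d' * subBlock X i (j + 1) + subBlock X (i + 1) (j + 1) := by
  constructor
  · intro h i hi j hj
    ext s t
    rw [← mul_jordanMat_apply X R P ⟨i, hi⟩ ⟨j, hj⟩, h]
    exact jordanMat_mul_apply X R P' ⟨i, hi⟩ ⟨j, hj⟩ s t
  · intro h
    ext ⟨i, s⟩ ⟨j, t⟩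
    rw [mul_jordanMat_apply, jordanMat_mul_apply, h i i.2 j j.2]

variable {X}

/-- Induction along the diagonals of the blocks of an intertwiner. -/
theorem subBlock_induction {p : Matrix (Fin d') (Fin d) F → Prop} (h0 : p 0)
    (hs : ∀ i < n, ∀ j < m, p (subBlock X i j) → p (subBlock X (i + 1) (j + 1)) →
      p (subBlock X i (j + 1))) :
    ∀ i j, j ≤ m → p (subBlock X i j) := by
  -- The measure is the distance from the lower left corner: the left neighbour and the lower
  -- neighbour of a cell are both one step closer.
  have key : ∀ k i j, i ≤ n → j ≤ m → n - i + j = k → p (subBlock X i j) := by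
    intro k
    induction k with
    | zero =>
      intro i j hi hj hk
      rw [show j = 0 by omega, subBlock_zero]
      exact h0
    | succ k ih =>
      intro i j hi hj hk
      rcases Nat.eq_zero_or_pos j with rfl | hj0
      · exact h0
      rcases hi.eq_or_lt with rfl | hi'
      · rw [subBlock_of_le X le_rfl]
        exact h0
      obtain ⟨j, rfl⟩ : ∃ l, j = l + 1 := ⟨j - 1, by omega⟩
      exact hs i hi' j (by omega) (ih i j hi (by omega) (by omega))
        (ih (i + 1) (j + 1) (by omega) hj (by omega))
  intro i j hj
  rcases le_total i n with hi | hi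
  · exact key _ i j hi hj rfl
  · rw [subBlock_of_le X hi]
    exact h0

theorem eq_zero_of_subBlock (h : ∀ i j, j ≤ m → subBlock X i j = 0) : X = 0 := by
  ext ⟨i, s⟩ ⟨j, t⟩
  rw [← subBlock_apply X, h _ _ j.2]
  rfl

theorem eq_zero_of_mul_jordanMat_eq {R : MatRep F} {P P' : F[X]} (hx : aeval (R.x P d) P = 0)
    (hx' : aeval (R.x P' d') P' = 0) (hPP : IsCoprime P' P)
    (h : X * jordanMat R P m d = jordanMat R P' n d' * X) : X = 0 := by
  rw [mul_jordanMat_eq_iff] at h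
  refine eq_zero_of_subBlock (subBlock_induction (p := (· = 0)) rfl fun i hi j hj h1 h2 => ?_)
  have h3 := h i hi j hj
  rw [h1, h2, add_zero, add_zero] at h3
  exact eq_zero_of_intertwine hx hx' hPP h3

/-- Over a separable polynomial, the blocks of an intertwiner commute with `x_p` and are constant
along the diagonals. -/
theorem commute_and_diagonal_of_mul_jordanMat_eq
    {X : Matrix (Fin n × Fin d) (Fin m × Fin d) F} {R : MatRep F} {P : F[X]}
    (hx : aeval (R.x P d) P = 0) (hsep : 2 ≤ n ∨ 2 ≤ m → P.Separable)
    (h : X * jordanMat R P m d = jordanMat R P n d * X) :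
    (∀ i j, j ≤ m → subBlock X i j * R.x P d = R.x P d * subBlock X i j) ∧
      ∀ i < n, ∀ j < m, subBlock X i j = subBlock X (i + 1) (j + 1) := by
  rw [mul_jordanMat_eq_iff] at h
  have hstep : ∀ i < n, ∀ j < m,
      subBlock X i j * R.x P d = R.x P d * subBlock X i j →
      subBlock X (i + 1) (j + 1) * R.x P d = R.x P d * subBlock X (i + 1) (j + 1) →
      subBlock X i j = subBlock X (i + 1) (j + 1) := by
    intro i hi j hj h1 h2
    by_cases hs : 2 ≤ n ∨ 2 ≤ m
    · rw [← sub_eq_zero]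
      -- The cell equation says that the difference of the two neighbours is the commutator of `x`
      -- with the cell between them.
      refine eq_zero_of_commutator (z := subBlock X i (j + 1)) hx (hsep hs) ?_ ?_
      · rw [sub_eq_sub_iff_add_eq_add, add_comm (subBlock X i j), h i hi j hj]
      · rw [mul_sub, sub_mul, h1, h2]
    -- If both sizes are one, both neighbours lie outside the matrix, and separability plays no
    -- role.
    · rw [show j = 0 by omega, subBlock_zero, subBlock_of_le X (by omega)]
  have hcomm : ∀ i j, j ≤ m → subBlock X i j * R.x P d = R.x P d * subBlock X i j := by
    refine subBlock_induction (p := fun Y => Y * R.x P d = R.x P d * Y)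
      (by rw [zero_mul, mul_zero]) fun i hi j hj h1 h2 => ?_
    have h3 := h i hi j hj
    rw [hstep i hi j hj h1 h2] at h3
    exact add_right_cancel h3
  exact ⟨hcomm, fun i hi j hj =>
    hstep i hi j hj (hcomm i j hj.le) (hcomm (i + 1) (j + 1) hj)⟩

/-- Intertwiners of two Jordan blocks of the same separable polynomial are Toeplitz. -/
theorem mul_jordanMat_eq_iff_toeplitz (R : MatRep F) {P : F[X]} (hm : P.Monic)
    (hP : Irreducible P) (hPd : P.natDegree = d) (hdd : d' = d)
    (hsep : 2 ≤ n ∨ 2 ≤ m → P.Separable) :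
    X * jordanMat R P m d = jordanMat R P n d' * X ↔
      ∃ r : ℕ → Matrix (Fin d) (Fin d) F, (∀ k, r k ∈ Algebra.adjoin F {R.x P d}) ∧
        ∀ s t, X s t = if (s.1 : ℕ) + (m - n) ≤ t.1 then
          r ((t.1 : ℕ) - s.1 - (m - n)) (Fin.cast hdd s.2) t.2 else 0 := by
  subst hdd
  have hx := R.aeval_x hm hP hPd
  constructor
  · intro h
    obtain ⟨hcomm, hdiag⟩ := commute_and_diagonal_of_mul_jordanMat_eq hx hsep h
    have hslide : ∀ k i j, i + k ≤ n → j + k ≤ m →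
        subBlock X i j = subBlock X (i + k) (j + k) := by
      intro k
      induction k with
      | zero => exact fun _ _ _ _ => rfl
      | succ k ih =>
        intro i j hi hj
        rw [ih i j (by omega) (by omega), hdiag _ (by omega) _ (by omega)]
        rfl
    -- The parameters are read off the top row, skipping the `m - n` leading columns; past the last
    -- column they are zero.
    refine ⟨fun k => subBlock X 0 (k + (m - n) + 1), fun k => ?_, ?_⟩
    · by_cases hk : k + (m - n) + 1 ≤ m
      · exact mem_adjoin_of_commute hP hPd hx (hcomm _ _ hk)
      · have h0 := subBlock_of_lt X (show m < k + (m - n) + 1 by omega) 0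
        simp only [h0]
        exact Subalgebra.zero_mem _
    · rintro ⟨i, s⟩ ⟨j, t⟩
      have hi := i.2
      have hj := j.2
      rw [← subBlock_apply X]
      split_ifs with hij
      · change _ = subBlock X 0 _ s t
        simp only at hij
        rw [show (j : ℕ) - i - (m - n) + (m - n) + 1 = j - i + 1 by omega,
          hslide i 0 (j - i + 1) (by omega) (by omega), zero_add,
          show (j : ℕ) - i + 1 + i = j + 1 by omega]
      · simp only at hij
        by_cases hji : (j : ℕ) + 1 ≤ i
        · have h1 := hslide (j + 1) (i - (j + 1)) 0 (by omega) (by omega)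
          rw [subBlock_zero, Nat.sub_add_cancel hji, zero_add] at h1
          rw [← h1]
          rfl
        · rw [hslide (n - i) i (j + 1) (by omega) (by omega), subBlock_of_le X (by omega)]
          rfl
  · rintro ⟨r, hr, hX⟩
    have hG : ∀ i < n, ∀ j < m, subBlock X i (j + 1) =
        if i + (m - n) ≤ j then r (j - i - (m - n)) else 0 := by
      intro i hi j hj
      ext s t
      have h1 := (subBlock_apply X ⟨i, hi⟩ ⟨j, hj⟩ s t).trans (hX _ _)
      simp only at h1
      rw [h1]
      split_ifs <;> rfl
    rw [mul_jordanMat_eq_iff]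
    intro i hi j hj
    congr 1
    · rw [hG i hi j hj]
      split_ifs
      · exact commute_of_mem_adjoin (hr _)
      · rw [zero_mul, mul_zero]
    · by_cases hi1 : i + 1 < n
      · rw [hG (i + 1) hi1 j hj]
        cases j with
        | zero => rw [if_neg (by omega), subBlock_zero]
        | succ j =>
          rw [hG i hi j (by omega)]
          split_ifs
          · congr 1
            omega
          · omega
          · omega
          · rfl
      · rw [subBlock_of_le X (i := i + 1) (by omega)]
        cases j with
        | zero => rfl
        | succ j => rw [hG i hi j (by omega), if_neg (by omega)]

end Toeplitz

/-! ## Intertwiners between `J(ℵ)` and `J((-1) ⋆ ℵ)` -/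

section Intertwiners

variable {F : Type u} [Field F]

theorem dil_neg_one_dil (P : F[X]) : dil (-1) (dil (-1) P) = P := by
  ext k
  simp only [dil, coeff_scaleRoots, natDegree_scaleRoots, mul_assoc, ← mul_pow]
  simp

theorem monic_dil {P : F[X]} (hP : P.Monic) (l : F) : (dil l P).Monic :=
  (monic_scaleRoots_iff l).2 hP

theorem dil_mul (P Q : F[X]) (l : F) : dil l (P * Q) = dil l P * dil l Q :=
  mul_scaleRoots_of_noZeroDivisors P Q l

/-- Dilation by `-1` is a multiplicative involution that preserves degrees, so factorisations and
units transfer back. -/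
theorem irreducible_dil {P : F[X]} (hP : Irreducible P) : Irreducible (dil (-1) P) := by
  have hu : ∀ Q : F[X], IsUnit (dil (-1) Q) → IsUnit Q := fun Q h => by
    have hne : dil (-1) Q ≠ 0 := h.ne_zero
    rw [Polynomial.isUnit_iff_degree_eq_zero] at h ⊢
    rwa [dil, degree_scaleRoots] at h
  refine ⟨fun h => hP.not_isUnit (hu _ h), fun {A B} hAB => ?_⟩
  have h1 : P = dil (-1) A * dil (-1) B := by rw [← dil_mul, ← hAB, dil_neg_one_dil]
  exact (hP.isUnit_or_isUnit h1).imp (hu _) (hu _)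

theorem separable_dil {P : F[X]} (hP : P.Separable) : (dil (-1) P).Separable := by
  -- Dilation by `-1` is the substitution of `-X`, up to a sign; a Bézout identity for `P` and its
  -- derivative survives this substitution.
  have hcomp : dil (-1) P = C ((-1) ^ P.natDegree) * P.comp (-X) := by
    ext k
    rw [coeff_C_mul, show P.comp (-X) = P.comp (C (-1) * X) by simp, comp_C_mul_X_coeff, dil,
      coeff_scaleRoots]
    by_cases hk : k ≤ P.natDegree
    · obtain ⟨e, he⟩ := Nat.exists_eq_add_of_le hk
      have h1 : (-1 : F) ^ k * (-1) ^ k = 1 := by rw [← mul_pow]; simp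
      rw [he, Nat.add_sub_cancel_left, pow_add]
      linear_combination (-(P.coeff k * (-1) ^ e)) * h1
    · rw [coeff_eq_zero_of_natDegree_lt (by omega)]
      simp
  have hu : IsUnit (C ((-1 : F) ^ P.natDegree)) :=
    isUnit_C.2 (IsUnit.pow _ isUnit_one.neg)
  rw [hcomp]
  obtain ⟨A, B, hAB⟩ := hP
  have hsep : (P.comp (-X)).Separable := by
    refine ⟨A.comp (-X), -B.comp (-X), ?_⟩
    have h := congrArg (fun Q : F[X] => Q.comp (-X)) hAB
    simp only [add_comp, mul_comp, one_comp] at h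
    rw [derivative_comp, derivative_neg, derivative_X]
    linear_combination h
  exact Separable.unit_mul hu hsep

theorem isIntertwiner_iff_isToeplitz (R : MatRep F) {a : MultFun.{u, v} F}
    (hsep : ∀ c : Blk a, 2 ≤ c.n → c.p.1.Separable) (C : Module.End F (VSp a)) :
    IsIntertwiner (jordan R a) (jordanDil R (-1) a) C ↔ IsToeplitz R C := by
  rw [jordan, jordanDil, isIntertwiner_blockDiag_iff, IsToeplitz]
  refine forall_congr' fun b => forall_congr' fun c => ?_
  have hmc := c.p.2.1
  have hic := c.p.2.2
  have hdeg : (dil (-1) b.p.1).natDegree = b.p.deg := natDegree_scaleRoots _ _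
  by_cases h : c.p.1 = dil (-1) b.p.1
  · have hdd : b.p.deg = c.p.deg := by rw [← hdeg, ← h]; rfl
    have hsepc : 2 ≤ (b.n : ℕ) ∨ 2 ≤ (c.n : ℕ) → c.p.1.Separable := by
      rintro (h2 | h2)
      -- If only the target block is large, separability is known for its own polynomial and is
      -- carried over by the dilation.
      · rw [h]
        exact separable_dil (hsep b h2)
      · exact hsep c h2
    have key := mul_jordanMat_eq_iff_toeplitz (X := block C b c) R hmc hic rfl hdd hsepc
    rw [show jordanMat R (dil (-1) b.p.1) b.n b.p.deg = jordanMat R c.p.1 b.n b.p.deg by rw [h]]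
    refine key.trans ?_
    exact ⟨fun h1 => ⟨fun h2 => absurd h h2, fun _ => h1⟩, fun h1 => h1.2 h⟩
  · have hcop : IsCoprime (dil (-1) b.p.1) c.p.1 := by
      refine ((irreducible_dil b.p.2.2).coprime_iff_not_dvd).2 fun hdvd => h ?_
      exact (eq_of_monic_of_associated (monic_dil b.p.2.1 _) hmc
        ((irreducible_dil b.p.2.2).associated_of_dvd hic hdvd)).symm
    constructor
    · intro h1
      have h0 : block C b c = 0 := eq_zero_of_mul_jordanMat_eq (R.aeval_x hmc hic rfl)
        (R.aeval_x (monic_dil b.p.2.1 _) (irreducible_dil b.p.2.2) hdeg) hcop h1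
      exact ⟨fun _ s t => congrFun (congrFun h0 s) t, fun h2 => absurd h2 h⟩
    · intro h1
      have h0 : block C b c = 0 := by
        ext s t
        exact h1.1 h s t
      rw [h0, Matrix.zero_mul, Matrix.mul_zero]

end Intertwiners

end JordAA

theorem mainTheorem4 {F : Type u} [Field F] (h2 : (2 : F) ≠ 0) (R : JordAA.MatRep F)
    (a : JordAA.MultFun.{u, v} F) :
    -- generators with `ad x = J(ℵ) x`: they exist, and for them `A = W(ℵ) V(-1; ℵ) C`
    (∃ b : Module.Basis (JordAA.Idx a) F (JordAA.VSp a), JordAA.IsColumnAdapted R b) ∧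
    (∀ b : Module.Basis (JordAA.Idx a) F (JordAA.VSp a), JordAA.IsColumnAdapted R b →
      JordAA.DescribesCasimirs (JordAA.jordan R a) b fun A =>
        ∃ C : Module.End F (JordAA.VSp a),
          JordAA.IsIntertwiner (JordAA.jordan R a) (JordAA.jordanDil R (-1) a) C ∧
          A = JordAA.wOp R a ∘ₗ JordAA.vOp a ∘ₗ C) ∧
    -- the Jordan basis itself: `A W(ℵ) = V(-1; ℵ) C`
    (JordAA.DescribesCasimirs (JordAA.jordan R a) Finsupp.basisSingleOne fun A =>
      ∃ C : Module.End F (JordAA.VSp a),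
        JordAA.IsIntertwiner (JordAA.jordan R a) (JordAA.jordanDil R (-1) a) C ∧
        A ∘ₗ JordAA.wOp R a = JordAA.vOp a ∘ₗ C) ∧
    -- the intertwiners `C`, block by block
    ((∀ c : JordAA.Blk a, 2 ≤ c.n → c.p.1.Separable) →
      ∀ C : Module.End F (JordAA.VSp a),
        JordAA.IsIntertwiner (JordAA.jordan R a) (JordAA.jordanDil R (-1) a) C ↔
          JordAA.IsToeplitz R C) := by
  refine ⟨JordAA.exists_isColumnAdapted R a, fun b hb => ?_, ?_,
    JordAA.isIntertwiner_iff_isToeplitz R⟩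
  · refine JordAA.describesCasimirs_of_hasBlocks h2
      (JordAA.hasBlocks_of_isColumnAdapted R a hb) fun A => ?_
    -- The blocks are `Jᵀ` here, and their transposes are `J` by definition.
    rw [JordAA.wOp_vOp_factor_iff, JordAA.lyapunov_eq_zero_iff]
    rfl
  · refine JordAA.describesCasimirs_of_hasBlocks h2
      (JordAA.hasBlocks_basisSingleOne R a) fun A => ?_
    rw [JordAA.mul_wOp_factor_iff, JordAA.lyapunov_eq_zero_iff]
    rfl
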